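/- **Conventions.** All spaces are over $\mathbb{C}$. A $\widehat\otimes$-algebra is a unital associative $\mathbb{C}$-algebra with a complete Hausdorff locally convex topology for which multiplication is jointly continuous; homomorphisms are unital and continuous. For a $\widehat\otimes$-algebra $A$, an $A$-$\widehat\otimes$-bimodule is a complete Hausdorff locally convex space that is a unital $A$-bimodule with jointly continuous actions; morphisms are continuous bimodule maps. A complex of locally convex spaces is admissible if it has a continuous $\mathbb{C}$-linear contracting homotopy. An $A$-$\widehat\otimes$-bimodule $P$ is projective if every morphism from $P$ to a bimodule $N$ lifts along every bimodule morphism $M\to N$ that has a continuous $\mathbb{C}$-linear right inverse. A projective resolution of $A$ is an admissible complex $0\leftarrow A\leftarrow P_0\leftarrow P_1\leftarrow\cdots$ of $A$-$\widehat\otimes$-bimodules with all $P_n$ projective. For a homomorphism $A\to B$ and an $A$-$\widehat\otimes$-bimodule $M$, $B\widehat\otimes_A M\widehat\otimes_A B$ is the Hausdorff completion of the quotient of the projective tensor product $B\otimes M\otimes B$ by the linear span of all elements $ba\otimes m\otimes c-b\otimes a m\otimes c$ and $b\otimes m a\otimes c-b\otimes m\otimes ac$. A homomorphism $A\to B$ of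 $\widehat\otimes$-algebras is called a homological epimorphism if it is an epimorphism in the category of $\widehat\otimes$-algebras and the functor $B\widehat\otimes_A(-)\widehat\otimes_A B$ sends some (equivalently, each) projective resolution $0\leftarrow A\leftarrow P_0\leftarrow P_1\leftarrow\cdots$ of the bimodule $A$ to an admissible complex. For $s\in[0,\infty)$ let $$\mathfrak{A}_s=\Bigl\{a=\sum_{n\ge 0}a_nz^n:\ \|a\|_{r,s}:=\sum_{n\ge 0}|a_n|\frac{r^n}{n!^s}<\infty\ \text{ for all } r>0\Bigr\},$$ with the topology given by the seminorms $\|\cdot\|_{r,s}$, $r>0$, and let $\mathfrak{A}_\infty=\mathbb{C}[[z]]$ with the topology of coefficientwise convergence. Endow $\mathbb{C}[z]$ with the strongest locally convex topology. **Proposition.** For every $s\in[0,\infty]$, $\mathbb{C}[z]$ and $\mathfrak{A}_s$ are $\widehat\otimes$-algebras and the natural embedding $\mathbb{C}[z]\to\mathfrak{A}_s$ is a homological epimorphism. -/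

import Mathlib

open scoped TensorProduct Polynomial NNReal

noncomputable section

universe u

namespace TopHomology

/-! ### Complete locally convex spaces, algebras and bimodules -/

/-- A complete Hausdorff locally convex space over `ℂ`. -/
class IsCompleteLCS (E : Type u) [AddCommGroup E] [Module ℂ E] [TopologicalSpace E] : Prop where
  isTopologicalAddGroup : IsTopologicalAddGroup E
  continuousSMul : ContinuousSMul ℂ E
  locallyConvex : LocallyConvexSpace ℝ E
  t2 : T2Space E
  complete : @CompleteSpace E (IsTopologicalAddGroup.rightUniformSpace E)

/-- A complete locally convex unital associative algebra with jointly continuous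
multiplication. -/
class IsHatAlgebra (A : Type u) [Ring A] [Algebra ℂ A] [TopologicalSpace A] : Prop extends
    IsCompleteLCS A, ContinuousMul A

/-- A (unital) `A`-`B`-bimodule whose underlying space is complete locally convex and whose actions
are jointly continuous. The right action of `b : B` is the action of `MulOpposite.op b`. -/
structure HatBimodule (A B : Type u) [Ring A] [Algebra ℂ A] [TopologicalSpace A]
    [Ring B] [Algebra ℂ B] [TopologicalSpace B] where
  carrier : Type u
  [addCommGroup : AddCommGroup carrier]
  [module : Module ℂ carrier]
  [topology : TopologicalSpace carrier]
  [completeLCS : IsCompleteLCS carrier]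
  [leftModule : Module A carrier]
  [rightModule : Module Bᵐᵒᵖ carrier]
  [bimodule : SMulCommClass A Bᵐᵒᵖ carrier]
  [leftTower : IsScalarTower ℂ A carrier]
  [rightTower : IsScalarTower ℂ Bᵐᵒᵖ carrier]
  [leftContinuous : ContinuousSMul A carrier]
  [rightContinuous : ContinuousSMul Bᵐᵒᵖ carrier]

attribute [instance] HatBimodule.addCommGroup HatBimodule.module HatBimodule.topology
  HatBimodule.completeLCS HatBimodule.leftModule HatBimodule.rightModule HatBimodule.bimodule
  HatBimodule.leftTower HatBimodule.rightTower HatBimodule.leftContinuous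
  HatBimodule.rightContinuous

/-- A continuous morphism of `A`-`B`-bimodules. -/
structure BimoduleHom (A B : Type u) [Ring A] [Ring B]
    (M N : Type u) [AddCommGroup M] [Module ℂ M] [TopologicalSpace M] [Module A M] [Module Bᵐᵒᵖ M]
    [AddCommGroup N] [Module ℂ N] [TopologicalSpace N] [Module A N] [Module Bᵐᵒᵖ N] where
  toCLM : M →L[ℂ] N
  map_left : ∀ (a : A) (m : M), toCLM (a • m) = a • toCLM m
  map_right : ∀ (b : B) (m : M), toCLM (MulOpposite.op b • m) = MulOpposite.op b • toCLM m

/-- An augmented sequence `0 ← X ← Y 0 ← Y 1 ← ⋯` of topological vector spaces is an admissible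
(that is, `ℂ`-split) complex: it is a complex with a continuous linear contracting homotopy. -/
def IsSplitComplex {X : Type u} [AddCommGroup X] [Module ℂ X] [TopologicalSpace X]
    {Y : ℕ → Type u} [∀ n, AddCommGroup (Y n)] [∀ n, Module ℂ (Y n)]
    [∀ n, TopologicalSpace (Y n)]
    (ε : Y 0 →L[ℂ] X) (d : ∀ n, Y (n + 1) →L[ℂ] Y n) : Prop :=
  (∀ y, ε (d 0 y) = 0) ∧ (∀ n y, d n (d (n + 1) y) = 0) ∧
  ∃ (h : X →L[ℂ] Y 0) (k : ∀ n, Y n →L[ℂ] Y (n + 1)),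
    (∀ x, ε (h x) = x) ∧
    (∀ y, h (ε y) + d 0 (k 0 y) = y) ∧
    (∀ n y, k n (d n y) + d (n + 1) (k (n + 1) y) = y)

section Projective

variable {A : Type u} [Ring A] [Algebra ℂ A] [TopologicalSpace A]

/-- Projectivity in the category of `A`-bimodules with respect to admissible epimorphisms, i.e.
bimodule morphisms that have a continuous `ℂ`-linear right inverse. -/
def IsProjective (P : HatBimodule A A) : Prop :=
  ∀ (M N : HatBimodule A A) (σ : BimoduleHom A A M.carrier N.carrier),
    (∃ s : N.carrier →L[ℂ] M.carrier, ∀ y, σ.toCLM (s y) = y) →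
    ∀ φ : BimoduleHom A A P.carrier N.carrier,
      ∃ ψ : BimoduleHom A A P.carrier M.carrier, ∀ p, σ.toCLM (ψ.toCLM p) = φ.toCLM p

variable (A) in
/-- A projective resolution `0 ← A ← P 0 ← P 1 ← ⋯` of `A` in the category of `A`-bimodules. -/
structure ProjResolution where
  P : ℕ → HatBimodule A A
  projective : ∀ n, IsProjective (P n)
  ε : BimoduleHom A A (P 0).carrier A
  d : ∀ n, BimoduleHom A A (P (n + 1)).carrier (P n).carrier
  split : IsSplitComplex (Y := fun n => (P n).carrier) ε.toCLM (fun n => (d n).toCLM)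

end Projective

/-! ### The functor `B ⊗̂_A (-) ⊗̂_A B` -/

section BaseChange

variable {A B : Type u} [Ring A] [Algebra ℂ A] [Ring B] [Algebra ℂ B] (f : A →ₐ[ℂ] B)

/-- The subspace of `B ⊗ M ⊗ B` spanned by the elements `b f(a) ⊗ m ⊗ c - b ⊗ a m ⊗ c` and
`b ⊗ m a ⊗ c - b ⊗ m ⊗ f(a) c`. -/
def balancing (M : Type u) [AddCommGroup M] [Module ℂ M] [Module A M] [Module Aᵐᵒᵖ M] :
    Submodule ℂ (B ⊗[ℂ] (M ⊗[ℂ] B)) :=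
  Submodule.span ℂ
    ({t | ∃ (a : A) (b c : B) (m : M),
        t = (b * f a) ⊗ₜ[ℂ] (m ⊗ₜ[ℂ] c) - b ⊗ₜ[ℂ] ((a • m) ⊗ₜ[ℂ] c)} ∪
     {t | ∃ (a : A) (b c : B) (m : M),
        t = b ⊗ₜ[ℂ] ((MulOpposite.op a • m) ⊗ₜ[ℂ] c) - b ⊗ₜ[ℂ] (m ⊗ₜ[ℂ] (f a * c))})

/-- The algebraic tensor product `B ⊗_A M ⊗_A B`. -/
def AlgBaseChange (M : Type u) [AddCommGroup M] [Module ℂ M] [Module A M] [Module Aᵐᵒᵖ M] :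
    Type u :=
  (B ⊗[ℂ] (M ⊗[ℂ] B)) ⧸ balancing f M

variable (M : Type u) [AddCommGroup M] [Module ℂ M] [Module A M] [Module Aᵐᵒᵖ M]

instance : AddCommGroup (AlgBaseChange f M) :=
  inferInstanceAs (AddCommGroup ((B ⊗[ℂ] (M ⊗[ℂ] B)) ⧸ balancing f M))

instance : Module ℂ (AlgBaseChange f M) :=
  inferInstanceAs (Module ℂ ((B ⊗[ℂ] (M ⊗[ℂ] B)) ⧸ balancing f M))

/-- The class of `b ⊗ m ⊗ c` in `B ⊗_A M ⊗_A B`. -/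
def AlgBaseChange.tmul (b : B) (m : M) (c : B) : AlgBaseChange f M :=
  (balancing f M).mkQ (b ⊗ₜ[ℂ] (m ⊗ₜ[ℂ] c))

section Functoriality

variable {M} [TopologicalSpace M] {N : Type u} [AddCommGroup N] [Module ℂ N]
  [TopologicalSpace N] [Module A N]
  [Module Aᵐᵒᵖ N]

theorem balancing_le_comap (φ : BimoduleHom A A M N) :
    balancing f M ≤ (balancing f N).comap
      (TensorProduct.map LinearMap.id (TensorProduct.map (φ.toCLM : M →ₗ[ℂ] N) LinearMap.id)) := by
  refine Submodule.span_le.2 ?_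
  rintro t (⟨a, b, c, m, rfl⟩ | ⟨a, b, c, m, rfl⟩)
  · refine Submodule.subset_span (Or.inl ⟨a, b, c, φ.toCLM m, ?_⟩)
    simp [φ.map_left]
  · refine Submodule.subset_span (Or.inr ⟨a, b, c, φ.toCLM m, ?_⟩)
    simp [φ.map_right]

/-- The linear map `1 ⊗ φ ⊗ 1 : B ⊗_A M ⊗_A B → B ⊗_A N ⊗_A B`. -/
def AlgBaseChange.mapLinear (φ : BimoduleHom A A M N) :
    AlgBaseChange f M →ₗ[ℂ] AlgBaseChange f N :=
  (balancing f M).mapQ (balancing f N)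
    (TensorProduct.map LinearMap.id (TensorProduct.map (φ.toCLM : M →ₗ[ℂ] N) LinearMap.id))
    (balancing_le_comap f φ)

theorem AlgBaseChange.mapLinear_tmul (φ : BimoduleHom A A M N) (b : B) (m : M) (c : B) :
    AlgBaseChange.mapLinear f φ (AlgBaseChange.tmul f M b m c) =
      AlgBaseChange.tmul f N b (φ.toCLM m) c := rfl

end Functoriality

variable [TopologicalSpace B] [TopologicalSpace M]

/-- The seminorms on `B ⊗_A M ⊗_A B` whose composition with the canonical trilinear map
`B × M × B → B ⊗_A M ⊗_A B` is jointly continuous. -/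
abbrev AlgBaseChange.ProjSeminorm : Type u :=
  {q : Seminorm ℂ (AlgBaseChange f M) //
    Continuous fun x : B × M × B => q (AlgBaseChange.tmul f M x.1 x.2.1 x.2.2)}

instance : Nonempty (AlgBaseChange.ProjSeminorm f M) :=
  ⟨⟨0, by simpa using continuous_const⟩⟩

/-- The family of all seminorms in `AlgBaseChange.ProjSeminorm`. -/
def AlgBaseChange.seminorms :
    SeminormFamily ℂ (AlgBaseChange f M) (AlgBaseChange.ProjSeminorm f M) :=
  fun q => q.1

/-- The projective topology: the strongest locally convex topology for which the canonical
trilinear map `B × M × B → B ⊗_A M ⊗_A B` is jointly continuous (equivalently, the quotient of the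
projective tensor product topology on `B ⊗ M ⊗ B`), with its translation-invariant uniformity. -/
instance : UniformSpace (AlgBaseChange f M) :=
  letI := (AlgBaseChange.seminorms f M).moduleFilterBasis.topology
  haveI := (AlgBaseChange.seminorms f M).addGroupFilterBasis.isTopologicalAddGroup
  IsTopologicalAddGroup.rightUniformSpace (AlgBaseChange f M)

theorem AlgBaseChange.withSeminorms : WithSeminorms (AlgBaseChange.seminorms f M) := ⟨rfl⟩

instance : IsTopologicalAddGroup (AlgBaseChange f M) :=
  (AlgBaseChange.withSeminorms f M).topologicalAddGroup

instance : ContinuousSMul ℂ (AlgBaseChange f M) :=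
  (AlgBaseChange.withSeminorms f M).continuousSMul

instance : IsUniformAddGroup (AlgBaseChange f M) :=
  @isUniformAddGroup_of_addCommGroup (AlgBaseChange f M) _
    (AlgBaseChange.seminorms f M).moduleFilterBasis.topology
    (AlgBaseChange.seminorms f M).addGroupFilterBasis.isTopologicalAddGroup

instance : UniformContinuousConstSMul ℂ (AlgBaseChange f M) :=
  uniformContinuousConstSMul_of_continuousConstSMul ℂ _

/-- The complete projective module tensor product `B ⊗̂_A M ⊗̂_A B`, i.e. the Hausdorff completion of
`B ⊗_A M ⊗_A B`. -/
abbrev BaseChange : Type u := UniformSpace.Completion (AlgBaseChange f M)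

variable {M} {N : Type u} [AddCommGroup N] [Module ℂ N] [TopologicalSpace N] [Module A N]
  [Module Aᵐᵒᵖ N]

theorem AlgBaseChange.continuous_mapLinear (φ : BimoduleHom A A M N) :
    Continuous (AlgBaseChange.mapLinear f φ) := by
  refine (AlgBaseChange.withSeminorms f M).continuous_of_isBounded
    (AlgBaseChange.withSeminorms f N) _ fun q => ?_
  have h : Continuous fun x : B × M × B =>
      q.1.comp (AlgBaseChange.mapLinear f φ) (AlgBaseChange.tmul f M x.1 x.2.1 x.2.2) :=
    q.2.comp (f := fun x : B × M × B => (x.1, φ.toCLM x.2.1, x.2.2)) (by fun_prop)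
  refine ⟨{⟨q.1.comp (AlgBaseChange.mapLinear f φ), h⟩}, 1, ?_⟩
  rw [one_smul, Finset.sup_singleton]
  exact le_refl (q.1.comp (AlgBaseChange.mapLinear f φ))

/-- The continuous linear map `1 ⊗ φ ⊗ 1 : B ⊗̂_A M ⊗̂_A B → B ⊗̂_A N ⊗̂_A B`. -/
def BaseChange.map (φ : BimoduleHom A A M N) : BaseChange f M →L[ℂ] BaseChange f N :=
  ContinuousLinearMap.completion
    ⟨AlgBaseChange.mapLinear f φ, AlgBaseChange.continuous_mapLinear f φ⟩

end BaseChange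

/-! ### Homological epimorphisms -/

/-- `f` is an epimorphism in the category of complete locally convex algebras with jointly
continuous multiplication. -/
def IsHatEpi {A B : Type u} [Ring A] [Algebra ℂ A] [Ring B] [Algebra ℂ B] [TopologicalSpace B]
    (f : A →ₐ[ℂ] B) : Prop :=
  ∀ (C : Type u) [Ring C] [Algebra ℂ C] [TopologicalSpace C] [IsHatAlgebra C]
    (g h : B →ₐ[ℂ] C), Continuous g → Continuous h → g.comp f = h.comp f → g = h

/-- `f : A → B` is a homological epimorphism: `A` and `B` are complete locally convex algebras with
jointly continuous multiplication, `f` is a continuous homomorphism that is an epimorphism, and the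
functor `B ⊗̂_A (-) ⊗̂_A B` sends some projective resolution of the bimodule `A` to an admissible
complex. -/
structure IsHomologicalEpi {A B : Type u} [Ring A] [Algebra ℂ A] [TopologicalSpace A]
    [Ring B] [Algebra ℂ B] [TopologicalSpace B] (f : A →ₐ[ℂ] B) : Prop where
  source : IsHatAlgebra A
  target : IsHatAlgebra B
  continuous : Continuous f
  epi : IsHatEpi f
  acyclic : ∃ R : ProjResolution A,
    IsSplitComplex (Y := fun n => BaseChange f (R.P n).carrier)
      (BaseChange.map f R.ε) (fun n => BaseChange.map f (R.d n))

/-! ### The polynomial algebra and its completions -/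

/-- The strongest locally convex topology on `ℂ[z]`, generated by all seminorms. -/
instance polynomialTopology : TopologicalSpace ℂ[X] :=
  SeminormFamily.moduleFilterBasis (𝕜 := ℂ) (F := ℂ[X]) (fun p : Seminorm ℂ ℂ[X] => p) |>.topology

/-- The weight `rⁿ / (n!)ˢ`. -/
def weight (s : ℝ≥0) (r : ℝ) (n : ℕ) : ℝ := r ^ n / (n.factorial : ℝ) ^ (s : ℝ)

theorem weight_nonneg (s : ℝ≥0) {r : ℝ} (hr : 0 < r) (n : ℕ) : 0 ≤ weight s r n := by
  unfold weight; positivity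

theorem weight_add_le (s : ℝ≥0) {r : ℝ} (hr : 0 < r) (m n : ℕ) :
    weight s r (m + n) ≤ weight s r m * weight s r n := by
  unfold weight
  rw [div_mul_div_comm, ← pow_add, ← Real.mul_rpow (by positivity) (by positivity)]
  have h : (m.factorial : ℝ) * (n.factorial : ℝ) ≤ ((m + n).factorial : ℝ) := by
    exact_mod_cast Nat.le_of_dvd (Nat.factorial_pos _) (Nat.factorial_mul_factorial_dvd_factorial_add m n)
  gcongr

theorem summable_mul_weight (s : ℝ≥0) {r : ℝ} (hr : 0 < r) {a b : PowerSeries ℂ}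
    (ha : Summable fun n => ‖PowerSeries.coeff n a‖ * weight s r n)
    (hb : Summable fun n => ‖PowerSeries.coeff n b‖ * weight s r n) :
    Summable fun n => ‖PowerSeries.coeff n (a * b)‖ * weight s r n := by
  have hab := ha.mul_of_nonneg hb
    (fun n => mul_nonneg (norm_nonneg (PowerSeries.coeff n a)) (weight_nonneg s hr n))
    (fun n => mul_nonneg (norm_nonneg (PowerSeries.coeff n b)) (weight_nonneg s hr n))
  refine Summable.of_nonneg_of_le
    (fun n => mul_nonneg (norm_nonneg _) (weight_nonneg s hr n)) (fun n => ?_)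
    (summable_sum_mul_antidiagonal_of_summable_mul (A := ℕ)
      (f := fun n => ‖PowerSeries.coeff n a‖ * weight s r n)
      (g := fun n => ‖PowerSeries.coeff n b‖ * weight s r n) hab)
  rw [PowerSeries.coeff_mul]
  refine (mul_le_mul_of_nonneg_right (norm_sum_le _ _) (weight_nonneg s hr n)).trans ?_
  rw [Finset.sum_mul]
  refine Finset.sum_le_sum fun p hp => ?_
  rw [← Finset.HasAntidiagonal.mem_antidiagonal.1 hp, norm_mul, mul_mul_mul_comm]
  exact mul_le_mul_of_nonneg_left (weight_add_le s hr _ _) (by positivity)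

theorem summable_polynomial_weight (s : ℝ≥0) (r : ℝ) (p : ℂ[X]) :
    Summable fun n => ‖PowerSeries.coeff n (p : PowerSeries ℂ)‖ * weight s r n := by
  refine summable_of_ne_finset_zero (s := p.support) fun n hn => ?_
  simp [Polynomial.notMem_support_iff.1 hn]

/-- The power series `∑ aₙ zⁿ` with `∑ |aₙ| rⁿ / (n!)ˢ < ∞` for all `r > 0`. -/
def powerSubalgebra (s : ℝ≥0) : Subalgebra ℂ (PowerSeries ℂ) where
  carrier := {a | ∀ r : ℝ, 0 < r → Summable fun n => ‖PowerSeries.coeff n a‖ * weight s r n}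
  mul_mem' ha hb r hr := summable_mul_weight s hr (ha r hr) (hb r hr)
  add_mem' {a b} ha hb r hr := by
    refine Summable.of_nonneg_of_le
      (fun n => mul_nonneg (norm_nonneg _) (weight_nonneg s hr n)) (fun n => ?_)
      ((ha r hr).add (hb r hr))
    rw [map_add, ← add_mul]
    exact mul_le_mul_of_nonneg_right (norm_add_le _ _) (weight_nonneg s hr n)
  algebraMap_mem' c r _ := by
    have h := summable_polynomial_weight s r (Polynomial.C c)
    rwa [Polynomial.coe_C] at h

/-- The algebra `𝔄_s` for finite `s`. -/
def PowerAlgebra (s : ℝ≥0) : Type := powerSubalgebra s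

instance (s : ℝ≥0) : CommRing (PowerAlgebra s) := inferInstanceAs (CommRing (powerSubalgebra s))

instance (s : ℝ≥0) : Algebra ℂ (PowerAlgebra s) := inferInstanceAs (Algebra ℂ (powerSubalgebra s))

/-- The inclusion of `𝔄_s` in `ℂ[[z]]`. -/
def PowerAlgebra.val (s : ℝ≥0) : PowerAlgebra s →ₐ[ℂ] PowerSeries ℂ := (powerSubalgebra s).val

/-- The seminorm `∑ |aₙ| rⁿ / (n!)ˢ` on `𝔄_s`. -/
def PowerAlgebra.seminorm (s : ℝ≥0) : SeminormFamily ℂ (PowerAlgebra s) {r : ℝ // 0 < r} :=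
  fun r => Seminorm.of
    (fun a => ∑' n, ‖PowerSeries.coeff n (PowerAlgebra.val s a)‖ * weight s r n)
    (fun a b => by
      have ha : Summable _ := a.2 r r.2
      have hb : Summable _ := b.2 r r.2
      have hab : Summable _ := (a + b).2 r r.2
      refine (hab.tsum_le_tsum (fun n => ?_) (ha.add hb)).trans_eq (ha.tsum_add hb)
      rw [← add_mul]
      exact mul_le_mul_of_nonneg_right (norm_add_le _ _) (weight_nonneg s r.2 n))
    (fun c a => by
      simp only [map_smul, norm_smul, mul_assoc]
      exact tsum_mul_left)

instance : Nonempty {r : ℝ // 0 < r} := ⟨⟨1, one_pos⟩⟩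

/-- The topology on `𝔄_s` generated by the seminorms `∑ |aₙ| rⁿ / (n!)ˢ`, `r > 0`. -/
instance (s : ℝ≥0) : TopologicalSpace (PowerAlgebra s) :=
  (PowerAlgebra.seminorm s).moduleFilterBasis.topology

/-- The embedding `ℂ[z] → 𝔄_s` for finite `s`. -/
def toPowerAlgebra (s : ℝ≥0) : ℂ[X] →ₐ[ℂ] PowerAlgebra s :=
  (Polynomial.coeToPowerSeries.algHom ℂ).codRestrict (powerSubalgebra s) fun p r _ => by
    have h := summable_polynomial_weight s r p
    simpa [Polynomial.coeToPowerSeries.algHom_apply] using h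

/-- The embedding `ℂ[z] → ℂ[[z]]`. -/
def toPowerSeries : ℂ[X] →ₐ[ℂ] PowerSeries ℂ := Polynomial.coeToPowerSeries.algHom ℂ

end TopHomology

end

open scoped PowerSeries.WithPiTopology

open scoped PowerSeries.WithPiTopology

noncomputable section

open Filter Topology ComplexOrder

/-! With the strongest locally convex topology every linear map from `ℂ[X]` into a complete locally
convex space is continuous, and because the dimension is countable, every bilinear map is jointly
continuous too. The bimodule `ℂ[X]` therefore has the Koszul resolution `0 ← ℂ[X] ← ℂ[X] ⊗ ℂ[X] ←
ℂ[X] ⊗ ℂ[X] ← 0` with differential `p ⊗ q ↦ pz ⊗ q - p ⊗ zq`, contracted by `q ↦ 1 ⊗ q` and by the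
divided difference `zⁿ ⊗ q ↦ ∑ zⁱ ⊗ zⁿ⁻¹⁻ⁱ q`.

Let `f : ℂ[X] → B` have dense range. Density gives the epimorphism property. It also makes the
elements `1 ⊗ m ⊗ 1` dense in the base change of any bimodule `M`, so the identities of the
contracted complex pass to the base change as soon as the homotopy is bounded for the induced
seminorms (`isSplitComplex_baseChange`).

Both kinds of target are weighted `ℓ¹`-algebras of power series with submultiplicative weights `W k`
(`IsWeightedPowerAlgebra`). On the base change of the free bimodule, the seminorms `∑ aₙ`-wise,
sending `∑ zⁿ ⊗ gₙ` to `∑ W m n * p m (f gₙ)`, are continuous (`continuous_baseChangeSeminorm`). The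
divided difference is then bounded (`isBaseChangeBounded_divDiff`) by the one real estimate, `∑ W k
i * W k (n - 1 - i) ≤ C * W l n` over `i < n`. For `rⁿ / n!ˢ` it follows from `n! ≤ 4ⁿ i! (n - 1 -
i)!`; for formal power series the weights are indicators of `n ≤ N`, and the sum vanishes for large
`n`. -/

namespace TopHomology

/-! ### Continuity of multilinear maps from seminorm bounds. -/

section Seminorms

variable {E F G H ι : Type*} [AddCommGroup E] [Module ℂ E] [AddCommGroup F] [Module ℂ F]
  [AddCommGroup G] [Module ℂ G] [AddCommGroup H] [Module ℂ H]

/-- A bilinear map which is bounded with respect to continuous seminorms is jointly continuous. -/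
theorem continuous_bilinear_of_bound [TopologicalSpace E] [IsTopologicalAddGroup E]
    [TopologicalSpace F] [IsTopologicalAddGroup F] [TopologicalSpace G]
    {q : SeminormFamily ℂ G ι} (hq : WithSeminorms q) (β : E →ₗ[ℂ] F →ₗ[ℂ] G)
    (h : ∀ i, ∃ (P : Seminorm ℂ E) (Q : Seminorm ℂ F), Continuous P ∧ Continuous Q ∧
      ∀ x y, q i (β x y) ≤ P x * Q y) :
    Continuous fun x : E × F => β x.1 x.2 := by
  rw [continuous_iff_continuousAt]
  rintro ⟨x₀, y₀⟩
  refine (hq.tendsto_nhds _ _).2 fun i ε hε => ?_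
  obtain ⟨P, Q, hP, hQ, hb⟩ := h i
  have hc : Continuous fun x : E × F => P (x.1 - x₀) * Q x.2 + P x₀ * Q (x.2 - y₀) := by fun_prop
  have ht := hc.tendsto (x₀, y₀)
  simp only [sub_self, map_zero, zero_mul, mul_zero, add_zero] at ht
  filter_upwards [ht.eventually (gt_mem_nhds hε)] with x hx
  refine lt_of_le_of_lt ?_ hx
  have e : β x.1 x.2 - β x₀ y₀ = β (x.1 - x₀) x.2 + β x₀ (x.2 - y₀) := by simp
  rw [e]
  exact (map_add_le_add _ _ _).trans (add_le_add (hb _ _) (hb _ _))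

/-- The composition of a seminorm with a trilinear map is continuous if it is bounded with respect
to continuous seminorms. -/
theorem continuous_seminorm_trilinear_of_bound [TopologicalSpace E] [IsTopologicalAddGroup E]
    [TopologicalSpace F] [IsTopologicalAddGroup F] [TopologicalSpace H] [IsTopologicalAddGroup H]
    (q : Seminorm ℂ G) (τ : E →ₗ[ℂ] F →ₗ[ℂ] H →ₗ[ℂ] G)
    {P : Seminorm ℂ E} {Q : Seminorm ℂ F} {R : Seminorm ℂ H}
    (hP : Continuous P) (hQ : Continuous Q) (hR : Continuous R)
    (hb : ∀ x y z, q (τ x y z) ≤ P x * Q y * R z) :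
    Continuous fun x : E × F × H => q (τ x.1 x.2.1 x.2.2) := by
  rw [continuous_iff_continuousAt]
  rintro ⟨x₀, y₀, z₀⟩
  have hc : Continuous fun x : E × F × H => P (x.1 - x₀) * Q x.2.1 * R x.2.2 +
      (P x₀ * Q (x.2.1 - y₀) * R x.2.2 + P x₀ * Q y₀ * R (x.2.2 - z₀)) := by fun_prop
  have ht := hc.tendsto (x₀, y₀, z₀)
  simp only [sub_self, map_zero, zero_mul, mul_zero, add_zero] at ht
  refine tendsto_iff_dist_tendsto_zero.2
    (squeeze_zero (fun _ => dist_nonneg) (fun x => ?_) ht)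
  rw [Real.dist_eq]
  refine (abs_sub_map_le_sub q _ _).trans ?_
  have e : τ x.1 x.2.1 x.2.2 - τ x₀ y₀ z₀ = τ (x.1 - x₀) x.2.1 x.2.2 +
      (τ x₀ (x.2.1 - y₀) x.2.2 + τ x₀ y₀ (x.2.2 - z₀)) := by simp
  rw [e]
  exact (map_add_le_add _ _ _).trans (add_le_add (hb _ _ _)
    ((map_add_le_add _ _ _).trans (add_le_add (hb _ _ _) (hb _ _ _))))

end Seminorms

/-! ### Weighted `ℓ¹`-spaces and their completeness. -/

section Koethe

variable {ι κ : Type*} {E : Type u} [AddCommGroup E] [Module ℂ E]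

/-- `E` is, via the coefficient map `c`, the space of all families of complex numbers that are
absolutely summable with respect to all weights `W k`, with the topology defined by the weighted
`ℓ¹`-seminorms. -/
structure IsKoethe [TopologicalSpace E] (c : E →ₗ[ℂ] (ι → ℂ)) (W : κ → ι → ℝ)
    (p : SeminormFamily ℂ E κ) : Prop where
  withSeminorms : WithSeminorms p
  nonneg : ∀ k i, 0 ≤ W k i
  pos : ∀ i, ∃ k, 0 < W k i
  hasSum : ∀ k x, HasSum (fun i => ‖c x i‖ * W k i) (p k x)
  injective : Function.Injective c
  exists_of_summable : ∀ a : ι → ℂ, (∀ k, Summable fun i => ‖a i‖ * W k i) → ∃ x, c x = a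

variable [TopologicalSpace E] {c : E →ₗ[ℂ] (ι → ℂ)} {W : κ → ι → ℝ} {p : SeminormFamily ℂ E κ}

theorem IsKoethe.sum_le (h : IsKoethe c W p) (k : κ) (x : E) (s : Finset ι) :
    ∑ i ∈ s, ‖c x i‖ * W k i ≤ p k x :=
  sum_le_hasSum s (fun i _ => mul_nonneg (norm_nonneg _) (h.nonneg k i)) (h.hasSum k x)

theorem IsKoethe.norm_mul_le (h : IsKoethe c W p) (k : κ) (x : E) (i : ι) :
    ‖c x i‖ * W k i ≤ p k x := by
  simpa using h.sum_le k x {i}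

/-- A Cauchy filter converges coefficientwise. Bounds on finite partial sums survive the limit,
which shows both that the limit family is summable and that convergence holds in each seminorm. -/
theorem IsKoethe.isCompleteLCS (h : IsKoethe c W p) : IsCompleteLCS E := by
  have := h.withSeminorms.topologicalAddGroup
  have := h.withSeminorms.continuousSMul
  have : T1Space E := h.withSeminorms.T1_of_separating fun x hx => by
    by_contra! hp
    refine hx (h.injective ?_)
    rw [map_zero]
    funext i
    obtain ⟨k, hk⟩ := h.pos i
    have := h.norm_mul_le k x i
    rw [hp k] at this
    exact norm_le_zero_iff.1 (nonpos_of_mul_nonpos_left this hk)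
  refine ⟨‹_›, ‹_›, h.withSeminorms.toLocallyConvexSpace, inferInstance, ?_⟩
  let _ : UniformSpace E := IsTopologicalAddGroup.rightUniformSpace E
  have : IsUniformAddGroup E := isUniformAddGroup_of_addCommGroup
  refine ⟨fun {l} hl => ?_⟩
  have := hl.1
  have hsub : Tendsto (fun x : E × E => x.2 - x.1) (l ×ˢ l) (𝓝 0) := by
    have := hl.2
    rw [uniformity_eq_comap_nhds_zero] at this
    exact tendsto_iff_comap.2 this
  have hcauchy : ∀ k, ∀ ε > 0, ∃ S ∈ l, ∀ x ∈ S, ∀ y ∈ S, p k (y - x) < ε := fun k ε hε => by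
    have := (h.withSeminorms.tendsto_nhds _ _).1 hsub k ε hε
    simp only [sub_zero] at this
    obtain ⟨S, hS, hS'⟩ := mem_prod_same_iff.1 this
    exact ⟨S, hS, fun x hx y hy => hS' (Set.mk_mem_prod hx hy)⟩
  have hlim : ∀ i, ∃ a : ℂ, Tendsto (fun x => c x i) l (𝓝 a) := fun i => by
    obtain ⟨k, hk⟩ := h.pos i
    refine cauchy_map_iff_exists_tendsto.1 (Metric.cauchy_iff.2 ⟨inferInstance, fun ε hε => ?_⟩)
    obtain ⟨S, hS, hS'⟩ := hcauchy k (ε * W k i) (mul_pos hε hk)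
    refine ⟨_, image_mem_map hS, ?_⟩
    rintro _ ⟨x, hx, rfl⟩ _ ⟨y, hy, rfl⟩
    have := (h.norm_mul_le k (x - y) i).trans_lt (hS' y hy x hx)
    rw [map_sub, Pi.sub_apply, ← dist_eq_norm] at this
    exact lt_of_mul_lt_mul_right this hk.le
  choose a ha using hlim
  -- The bound is uniform in the finite set `s`, so it will pass to the full sum; it comes from
  -- letting `y` run along `l` in the Cauchy estimate.
  have key : ∀ k, ∀ ε > 0, ∃ S ∈ l, ∀ x ∈ S, ∀ s : Finset ι,
      ∑ i ∈ s, ‖c x i - a i‖ * W k i ≤ ε := fun k ε hε => by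
    obtain ⟨S, hS, hS'⟩ := hcauchy k ε hε
    refine ⟨S, hS, fun x hx s => ?_⟩
    have ht : Tendsto (fun y => ∑ i ∈ s, ‖c x i - c y i‖ * W k i) l
        (𝓝 (∑ i ∈ s, ‖c x i - a i‖ * W k i)) :=
      tendsto_finsetSum _ fun i _ => ((tendsto_const_nhds.sub (ha i)).norm).mul_const _
    refine le_of_tendsto ht (mem_of_superset hS fun y hy => ?_)
    have := (h.sum_le k (x - y) s).trans (hS' y hy x hx).le
    simpa using this
  have hsum : ∀ k, Summable fun i => ‖a i‖ * W k i := fun k => by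
    obtain ⟨S, hS, hS'⟩ := key k 1 one_pos
    obtain ⟨x, hx⟩ := nonempty_of_mem hS
    have h1 : Summable fun i => ‖c x i - a i‖ * W k i :=
      summable_of_sum_le (fun i => mul_nonneg (norm_nonneg _) (h.nonneg k i)) (hS' x hx)
    refine Summable.of_nonneg_of_le (fun i => mul_nonneg (norm_nonneg _) (h.nonneg k i))
      (fun i => ?_) ((h.hasSum k x).summable.add h1)
    rw [← add_mul]
    refine mul_le_mul_of_nonneg_right ?_ (h.nonneg k i)
    have := norm_sub_le (c x i) (c x i - a i)
    simpa using this
  obtain ⟨z, hz⟩ := h.exists_of_summable a hsum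
  refine ⟨z, (h.withSeminorms.tendsto_nhds id z).2 fun k ε hε => ?_⟩
  obtain ⟨S, hS, hS'⟩ := key k (ε / 2) (half_pos hε)
  refine mem_of_superset hS fun x hx => ?_
  refine lt_of_le_of_lt ?_ (half_lt_self hε)
  refine (h.hasSum k (id x - z)).tsum_eq ▸
    (h.hasSum k (id x - z)).summable.tsum_le_of_sum_le fun s => ?_
  have := hS' x hx s
  simpa [hz] using this

end Koethe

/-! ### The strongest locally convex topology and its weighted `ℓ¹` description. -/

section Finest

variable {ι : Type*} {E : Type u} [AddCommGroup E] [Module ℂ E]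

theorem summable_basis (b : Module.Basis ι ℂ E) (w : ι → ℝ≥0) (x : E) :
    Summable fun i => ‖b.repr x i‖ * w i :=
  summable_of_ne_finset_zero (s := (b.repr x).support) fun i hi => by
    simp [Finsupp.notMem_support_iff.1 hi]

/-- The weighted `ℓ¹`-seminorm defined by a basis. -/
def basisSeminorm (b : Module.Basis ι ℂ E) : SeminormFamily ℂ E (ι → ℝ≥0) := fun w =>
  Seminorm.of (fun x => ∑' i, ‖b.repr x i‖ * w i)
    (fun x y => by
      rw [← (summable_basis b w x).tsum_add (summable_basis b w y)]
      refine (summable_basis b w (x + y)).tsum_le_tsum (fun i => ?_)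
        ((summable_basis b w x).add (summable_basis b w y))
      rw [← add_mul, map_add]
      exact mul_le_mul_of_nonneg_right (norm_add_le _ _) (w i).2)
    (fun a x => by
      have h : ∀ i, ‖b.repr (a • x) i‖ * (w i : ℝ) = ‖a‖ * (‖b.repr x i‖ * w i) := fun i => by
        rw [map_smul, Finsupp.smul_apply, norm_smul, mul_assoc]
      simp only [h]
      exact tsum_mul_left)

theorem basisSeminorm_apply (b : Module.Basis ι ℂ E) (w : ι → ℝ≥0) (x : E) :
    basisSeminorm b w x = ∑' i, ‖b.repr x i‖ * w i := rfl

theorem basisSeminorm_eq_sum (b : Module.Basis ι ℂ E) (w : ι → ℝ≥0) (x : E) :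
    basisSeminorm b w x = (b.repr x).sum fun i a => ‖a‖ * w i :=
  tsum_eq_sum fun i hi => by simp [Finsupp.notMem_support_iff.1 hi]

/-- Expand `x` in the basis and use subadditivity. This makes the basis seminorms cofinal among all
seminorms. -/
theorem seminorm_le_basisSeminorm (b : Module.Basis ι ℂ E) (q : Seminorm ℂ E) (w : ι → ℝ≥0)
    (h : ∀ i, q (b i) ≤ w i) : q ≤ basisSeminorm b w := fun x => by
  rw [basisSeminorm_eq_sum]
  conv_lhs => rw [← b.linearCombination_repr x, Finsupp.linearCombination_apply]
  refine (Finset.le_sum_of_subadditive q (map_zero q).le (map_add_le_add q) _ _).trans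
    (Finset.sum_le_sum fun i _ => ?_)
  rw [map_smul_eq_mul]
  exact mul_le_mul_of_nonneg_left (h i) (norm_nonneg _)

/-- Bilinear maps of spaces with bases are bounded by products of weighted seminorms if they are so
on basis vectors. -/
theorem seminorm_bilinear_le {F G : Type*} [AddCommGroup F] [Module ℂ F]
    [AddCommGroup G] [Module ℂ G] (b : Module.Basis ι ℂ E) (q : Seminorm ℂ G)
    (Q : Seminorm ℂ F) (β : E →ₗ[ℂ] F →ₗ[ℂ] G) (w : ι → ℝ≥0)
    (h : ∀ i y, q (β (b i) y) ≤ w i * Q y) (x : E) (y : F) :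
    q (β x y) ≤ basisSeminorm b w x * Q y := by
  rw [basisSeminorm_eq_sum]
  conv_lhs => rw [← b.linearCombination_repr x, Finsupp.linearCombination_apply]
  simp only [Finsupp.sum, map_sum, map_smul, LinearMap.sum_apply, LinearMap.smul_apply]
  refine (Finset.le_sum_of_subadditive q (map_zero q).le (map_add_le_add q) _ _).trans ?_
  rw [Finset.sum_mul]
  refine Finset.sum_le_sum fun i _ => ?_
  rw [map_smul_eq_mul, mul_assoc]
  exact mul_le_mul_of_nonneg_left (h i y) (norm_nonneg _)

variable [TopologicalSpace E]

variable (E) in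
/-- The topology of `E` is the strongest locally convex topology. -/
def IsFinest : Prop := WithSeminorms fun p : Seminorm ℂ E => p

theorem IsFinest.continuous (hE : IsFinest E) (q : Seminorm ℂ E) : Continuous q :=
  WithSeminorms.continuous_seminorm hE q

theorem IsFinest.isKoethe (hE : IsFinest E) (b : Module.Basis ι ℂ E) :
    IsKoethe (Finsupp.lcoeFun.comp b.repr.toLinearMap) (fun (w : ι → ℝ≥0) i => (w i : ℝ))
      (basisSeminorm b) where
  withSeminorms := by
    refine WithSeminorms.congr hE (fun w => ⟨{basisSeminorm b w}, 1, ?_⟩) (fun q => ?_)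
    · rw [one_smul, Finset.sup_singleton]
      exact le_refl (basisSeminorm b w)
    · refine ⟨{fun i => (q (b i)).toNNReal}, 1, ?_⟩
      rw [one_smul, Finset.sup_singleton]
      exact seminorm_le_basisSeminorm b q _ fun i => Real.le_coe_toNNReal _
  nonneg w i := (w i).2
  pos i := ⟨fun _ => 1, one_pos⟩
  hasSum w x := (summable_basis b w x).hasSum
  injective := DFunLike.coe_injective.comp b.repr.injective
  exists_of_summable a ha := by
    -- The weight `‖a i‖⁻¹` (zero where `a i = 0`) turns every nonzero term into `1`, while the
    -- terms of a summable family are eventually below `1` off a finite set.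
    have hf : {i | a i ≠ 0}.Finite := by
      have h := (ha fun i => ‖a i‖₊⁻¹).tendsto_cofinite_zero
      have h1 := h.eventually (gt_mem_nhds (zero_lt_one' ℝ))
      refine (eventually_cofinite.1 h1).subset fun i hi => ?_
      have : ‖a i‖ ≠ 0 := norm_ne_zero_iff.2 hi
      simp [this]
    refine ⟨b.repr.symm (Finsupp.ofSupportFinite a hf), ?_⟩
    ext i
    simp [Finsupp.ofSupportFinite]
    rfl

theorem IsFinest.isCompleteLCS (hE : IsFinest E) : IsCompleteLCS E :=
  (hE.isKoethe (Module.Basis.ofVectorSpace ℂ E)).isCompleteLCS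

/-- Convexity over `ℝ` and over `ℂ` agree, so the topology is given by its continuous complex
seminorms; continuity can then be tested on these. -/
theorem IsCompleteLCS.polynormable (h : IsCompleteLCS E) : PolynormableSpace ℂ E := by
  have := h.isTopologicalAddGroup
  have := h.continuousSMul
  have := h.locallyConvex
  have : LocallyConvexSpace ℂ E := by
    refine (locallyConvexSpace_iff_exists_convex_subset_zero ℂ E).2 fun U hU => ?_
    obtain ⟨S, hS, hc, hSU⟩ := (locallyConvexSpace_iff_exists_convex_subset_zero ℝ E).1 ‹_› U hU
    exact ⟨S, hS, convex_RCLike_iff_convex_real.2 hc, hSU⟩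
  have : ContinuousSMul ℝ E := IsScalarTower.continuousSMul ℂ
  infer_instance

theorem IsFinest.continuous_linearMap (hE : IsFinest E) {F : Type u} [AddCommGroup F] [Module ℂ F]
    [TopologicalSpace F] (hF : IsCompleteLCS F) (φ : E →ₗ[ℂ] F) : Continuous φ := by
  have := hF.polynormable
  have := hE.isCompleteLCS.isTopologicalAddGroup
  exact (PolynormableSpace.withSeminorms ℂ F).continuous_of_continuous_comp φ fun q =>
    hE.continuous (q.1.comp φ)

/-- Take `t n ≥ 1` dominating all `D i j` with `i, j ≤ n`; the factor with the larger index already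
suffices. This is where countability enters joint continuity. -/
theorem exists_weight_mul_ge (D : ℕ → ℕ → ℝ≥0) :
    ∃ t : ℕ → ℝ≥0, ∀ i j, D i j ≤ t i * t j := by
  let t : ℕ → ℝ≥0 := fun n => 1 + ∑ i ∈ Finset.range (n + 1), ∑ j ∈ Finset.range (n + 1), D i j
  have h1 : ∀ n, 1 ≤ t n := fun n => le_self_add
  have h2 : ∀ n i j, i ≤ n → j ≤ n → D i j ≤ t n := fun n i j hi hj => by
    refine le_trans ?_ le_add_self
    refine le_trans ?_ (Finset.single_le_sum (f := fun i => ∑ j ∈ Finset.range (n + 1), D i j)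
      (fun _ _ => zero_le) (Finset.mem_range.2 (Nat.lt_succ_of_le hi)))
    exact Finset.single_le_sum (f := fun j => D i j) (fun _ _ => zero_le)
      (Finset.mem_range.2 (Nat.lt_succ_of_le hj))
  refine ⟨t, fun i j => ?_⟩
  rcases le_total i j with h | h
  · exact (h2 j i j h le_rfl).trans (le_mul_of_one_le_left (zero_le) (h1 i))
  · exact (h2 i i j le_rfl h).trans (le_mul_of_one_le_right (zero_le) (h1 j))

/-- Bilinear maps of spaces of countable dimension with the strongest locally convex topologies are
jointly continuous. -/
theorem IsFinest.continuous_bilinear {ι' : Type*} [Countable ι] [Countable ι'] {F G : Type u}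
    [AddCommGroup F] [Module ℂ F] [TopologicalSpace F] [AddCommGroup G] [Module ℂ G]
    [TopologicalSpace G] (hE : IsFinest E) (hF : IsFinest F) (hG : IsCompleteLCS G)
    (b : Module.Basis ι ℂ E) (b' : Module.Basis ι' ℂ F) (β : E →ₗ[ℂ] F →ₗ[ℂ] G) :
    Continuous fun x : E × F => β x.1 x.2 := by
  have := hG.polynormable
  have := hE.isCompleteLCS.isTopologicalAddGroup
  have := hF.isCompleteLCS.isTopologicalAddGroup
  obtain ⟨e, he⟩ := Countable.exists_injective_nat ι
  obtain ⟨e', he'⟩ := Countable.exists_injective_nat ι'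
  refine continuous_bilinear_of_bound (PolynormableSpace.withSeminorms ℂ G) β fun q => ?_
  -- The values on pairs of basis vectors are transported to `ℕ × ℕ` along the injections and set to
  -- zero elsewhere.
  obtain ⟨t, ht⟩ := exists_weight_mul_ge (Function.extend e (fun i =>
    Function.extend e' (fun j => (q.1 (β (b i) (b' j))).toNNReal) 0) 0)
  have ht' : ∀ i j, q.1 (β (b i) (b' j)) ≤ t (e i) * t (e' j) := fun i j => by
    have h := ht (e i) (e' j)
    rw [he.extend_apply, he'.extend_apply] at h
    exact (Real.le_coe_toNNReal _).trans (by exact_mod_cast h)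
  refine ⟨basisSeminorm b (t ∘ e), basisSeminorm b' (t ∘ e'), hE.continuous _, hF.continuous _,
    seminorm_bilinear_le b q.1 _ β _ fun i y => ?_⟩
  have h := seminorm_le_basisSeminorm b' (q.1.comp (β (b i))) (fun j => t (e i) * t (e' j))
    (fun j => by simpa using ht' i j) y
  refine h.trans_eq ?_
  rw [basisSeminorm_apply, basisSeminorm_apply, ← tsum_mul_left]
  exact tsum_congr fun j => by push_cast; simp only [Function.comp]; ring

end Finest

/-! ### The free bimodule `ℂ[X] ⊗ ℂ[X]` and its projectivity. -/

section FreeBimodule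

open Polynomial

/-- The strongest locally convex topology. -/
@[reducible]
def finestTopology (E : Type u) [AddCommGroup E] [Module ℂ E] : TopologicalSpace E :=
  SeminormFamily.moduleFilterBasis (𝕜 := ℂ) (F := E) (fun p : Seminorm ℂ E => p) |>.topology

theorem isFinest_finestTopology (E : Type u) [AddCommGroup E] [Module ℂ E] :
    @IsFinest E _ _ (finestTopology E) :=
  @WithSeminorms.mk _ _ _ _ _ _ _ (finestTopology E) rfl

theorem isFinest_polynomial : IsFinest ℂ[X] := isFinest_finestTopology ℂ[X]

theorem isHatAlgebra_polynomial : IsHatAlgebra ℂ[X] where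
  toIsCompleteLCS := isFinest_polynomial.isCompleteLCS
  continuous_mul := isFinest_polynomial.continuous_bilinear isFinest_polynomial
    isFinest_polynomial.isCompleteLCS (basisMonomials ℂ) (basisMonomials ℂ) (LinearMap.mul ℂ ℂ[X])

/-- The free bimodule `ℂ[z] ⊗ ℂ[z]`. -/
def FreeTensor : Type := ℂ[X] ⊗[ℂ] ℂ[X]

instance : CommRing FreeTensor := inferInstanceAs (CommRing (ℂ[X] ⊗[ℂ] ℂ[X]))

instance : Algebra ℂ FreeTensor := inferInstanceAs (Algebra ℂ (ℂ[X] ⊗[ℂ] ℂ[X]))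

instance : TopologicalSpace FreeTensor := finestTopology FreeTensor

/-- The embedding of the first factor. -/
def FreeTensor.left : ℂ[X] →ₐ[ℂ] FreeTensor :=
  (Algebra.TensorProduct.includeLeft : ℂ[X] →ₐ[ℂ] ℂ[X] ⊗[ℂ] ℂ[X])

/-- The embedding of the second factor. -/
def FreeTensor.right : ℂ[X] →ₐ[ℂ] FreeTensor :=
  (Algebra.TensorProduct.includeRight : ℂ[X] →ₐ[ℂ] ℂ[X] ⊗[ℂ] ℂ[X])

instance : Module ℂ[X] FreeTensor := Module.compHom FreeTensor FreeTensor.left.toRingHom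

instance : Module ℂ[X]ᵐᵒᵖ FreeTensor :=
  Module.compHom FreeTensor
    (FreeTensor.right.toRingHom.comp (RingEquiv.toOpposite ℂ[X]).symm.toRingHom)

theorem FreeTensor.smul_def (a : ℂ[X]) (x : FreeTensor) : a • x = FreeTensor.left a * x := rfl

theorem FreeTensor.op_smul_def (a : ℂ[X]ᵐᵒᵖ) (x : FreeTensor) :
    a • x = FreeTensor.right a.unop * x := rfl

theorem isFinest_freeTensor : IsFinest FreeTensor := isFinest_finestTopology FreeTensor

/-- The basis of `ℂ[z] ⊗ ℂ[z]` consisting of tensor products of monomials. -/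
def FreeTensor.basis : Module.Basis (ℕ × ℕ) ℂ FreeTensor :=
  (basisMonomials ℂ).tensorProduct (basisMonomials ℂ)

/-- The free bimodule `ℂ[z] ⊗ ℂ[z]` with the strongest locally convex topology. -/
def freeBimodule : HatBimodule ℂ[X] ℂ[X] where
  carrier := FreeTensor
  completeLCS := isFinest_freeTensor.isCompleteLCS
  bimodule := ⟨fun a c x => by
    rw [FreeTensor.smul_def, FreeTensor.op_smul_def, FreeTensor.smul_def, FreeTensor.op_smul_def,
      mul_left_comm]⟩
  leftTower := ⟨fun c a x => by
    rw [FreeTensor.smul_def, FreeTensor.smul_def, map_smul, smul_mul_assoc]⟩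
  rightTower := ⟨fun c a x => by
    rw [FreeTensor.op_smul_def, FreeTensor.op_smul_def, MulOpposite.unop_smul, map_smul,
      smul_mul_assoc]⟩
  -- Joint continuity of both actions rests on the countability of the monomial bases.
  leftContinuous := ⟨isFinest_polynomial.continuous_bilinear isFinest_freeTensor
    isFinest_freeTensor.isCompleteLCS (basisMonomials ℂ) FreeTensor.basis
    ((LinearMap.mul ℂ FreeTensor).comp FreeTensor.left.toLinearMap)⟩
  rightContinuous := ⟨(isFinest_polynomial.continuous_bilinear isFinest_freeTensor
    isFinest_freeTensor.isCompleteLCS (basisMonomials ℂ) FreeTensor.basis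
    ((LinearMap.mul ℂ FreeTensor).comp FreeTensor.right.toLinearMap)).comp
      ((MulOpposite.continuous_unop.comp continuous_fst).prodMk continuous_snd)⟩

theorem isFinest_freeBimodule : IsFinest freeBimodule.carrier := isFinest_freeTensor

/-- The canonical bilinear map to the free bimodule. -/
def freeTmul : ℂ[X] →ₗ[ℂ] ℂ[X] →ₗ[ℂ] freeBimodule.carrier := TensorProduct.mk ℂ ℂ[X] ℂ[X]

theorem smul_freeTmul (a p q : ℂ[X]) : a • freeTmul p q = freeTmul (a * p) q := by
  change (a ⊗ₜ[ℂ] (1 : ℂ[X])) * (p ⊗ₜ[ℂ] q) = (a * p) ⊗ₜ[ℂ] q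
  rw [Algebra.TensorProduct.tmul_mul_tmul, one_mul]

theorem op_smul_freeTmul (a p q : ℂ[X]) :
    MulOpposite.op a • freeTmul p q = freeTmul p (q * a) := by
  change ((1 : ℂ[X]) ⊗ₜ[ℂ] a) * (p ⊗ₜ[ℂ] q) = p ⊗ₜ[ℂ] (q * a)
  rw [Algebra.TensorProduct.tmul_mul_tmul, one_mul, mul_comm]

/-- The linear map on the free bimodule defined by a bilinear map. -/
def freeLift {G : Type*} [AddCommGroup G] [Module ℂ G] (β : ℂ[X] →ₗ[ℂ] ℂ[X] →ₗ[ℂ] G) :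
    freeBimodule.carrier →ₗ[ℂ] G :=
  TensorProduct.lift β

@[simp]
theorem freeLift_freeTmul {G : Type*} [AddCommGroup G] [Module ℂ G]
    (β : ℂ[X] →ₗ[ℂ] ℂ[X] →ₗ[ℂ] G) (p q : ℂ[X]) : freeLift β (freeTmul p q) = β p q :=
  TensorProduct.lift.tmul p q

theorem free_induction {C : freeBimodule.carrier → Prop} (x : freeBimodule.carrier)
    (h : ∀ p q, C (freeTmul p q)) (hadd : ∀ x y, C x → C y → C (x + y)) : C x :=
  TensorProduct.induction_on (motive := C) x
    (by have := h 0 0; rwa [map_zero] at this) h hadd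

/-- Only powers of `X` are needed on the left, which is where the divided difference has an explicit
formula. -/
theorem free_hom_ext {G : Type*} [AddCommGroup G] [Module ℂ G]
    {φ ψ : freeBimodule.carrier →ₗ[ℂ] G}
    (h : ∀ (n : ℕ) (q : ℂ[X]), φ (freeTmul (X ^ n) q) = ψ (freeTmul (X ^ n) q)) : φ = ψ := by
  have e : freeTmul.compr₂ φ = freeTmul.compr₂ ψ := by
    refine (basisMonomials ℂ).ext fun n => LinearMap.ext fun q => ?_
    simpa [← X_pow_eq_monomial] using h n q
  refine LinearMap.ext fun x => ?_
  induction x using free_induction with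
  | h p q => exact LinearMap.congr_fun (LinearMap.congr_fun e p) q
  | hadd x y hx hy => rw [map_add, map_add, hx, hy]

section Generate

variable {M : Type} [AddCommGroup M] [Module ℂ M] [Module ℂ[X] M] [Module ℂ[X]ᵐᵒᵖ M]
  [IsScalarTower ℂ ℂ[X] M] [IsScalarTower ℂ ℂ[X]ᵐᵒᵖ M]

/-- The linear map `p ⊗ q ↦ p e q`. -/
def freeGenLinear (e : M) : freeBimodule.carrier →ₗ[ℂ] M :=
  freeLift (LinearMap.mk₂ ℂ (fun p q => p • MulOpposite.op q • e)
    (fun p p' q => add_smul _ _ _)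
    (fun c p q => smul_assoc _ _ _)
    (fun p q q' => by rw [MulOpposite.op_add, add_smul, smul_add])
    (fun c p q => by
      rw [MulOpposite.op_smul, smul_assoc, ← algebraMap_smul ℂ[X] c,
        ← algebraMap_smul ℂ[X] c, smul_smul, smul_smul, mul_comm]))

@[simp]
theorem freeGenLinear_freeTmul (e : M) (p q : ℂ[X]) :
    freeGenLinear e (freeTmul p q) = p • MulOpposite.op q • e := by
  simp [freeGenLinear]

variable [TopologicalSpace M] [SMulCommClass ℂ[X] ℂ[X]ᵐᵒᵖ M]

/-- The bimodule morphism `p ⊗ q ↦ p e q`. -/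
def freeGen (hM : IsCompleteLCS M) (e : M) :
    BimoduleHom ℂ[X] ℂ[X] freeBimodule.carrier M where
  toCLM := ⟨freeGenLinear e, isFinest_freeBimodule.continuous_linearMap hM _⟩
  map_left a m := by
    change freeGenLinear e _ = a • freeGenLinear e _
    induction m using free_induction with
    | h p q => rw [smul_freeTmul, freeGenLinear_freeTmul, freeGenLinear_freeTmul, mul_smul]
    | hadd x y hx hy => rw [smul_add, map_add, hx, hy, map_add, smul_add]
  map_right a m := by
    change freeGenLinear e _ = MulOpposite.op a • freeGenLinear e _
    induction m using free_induction with
    | h p q =>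
      rw [op_smul_freeTmul, freeGenLinear_freeTmul, freeGenLinear_freeTmul, MulOpposite.op_mul,
        mul_smul, smul_comm]
    | hadd x y hx hy => rw [smul_add, map_add, hx, hy, map_add, smul_add]

theorem freeGen_freeTmul (hM : IsCompleteLCS M) (e : M) (p q : ℂ[X]) :
    (freeGen hM e).toCLM (freeTmul p q) = p • MulOpposite.op q • e :=
  freeGenLinear_freeTmul e p q

end Generate

/-- The bimodule is generated freely by `1 ⊗ 1`, so a lift is determined by any preimage of the
image of this generator; the linear section supplies one. -/
theorem isProjective_freeBimodule : IsProjective freeBimodule := by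
  rintro M N σ ⟨s, hs⟩ φ
  refine ⟨freeGen M.completeLCS (s (φ.toCLM (freeTmul 1 1))), fun x => ?_⟩
  induction x using free_induction with
  | h p q =>
    rw [freeGen_freeTmul, σ.map_left, σ.map_right, hs, ← φ.map_right, ← φ.map_left,
      op_smul_freeTmul, smul_freeTmul, one_mul, mul_one]
  | hadd x y hx hy => rw [map_add, map_add, hx, hy, map_add]

theorem isCompleteLCS_punit : IsCompleteLCS PUnit.{1} :=
  ⟨inferInstance, inferInstance, inferInstance, inferInstance,
    @CompleteSpace.mk _ (IsTopologicalAddGroup.rightUniformSpace PUnit) fun {f} _ =>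
      ⟨PUnit.unit, by
        rw [nhds_discrete, Filter.le_pure_iff]
        exact f.mem_of_superset univ_mem fun _ _ => rfl⟩⟩

/-- The zero bimodule. -/
def zeroBimodule : HatBimodule ℂ[X] ℂ[X] where
  carrier := PUnit
  completeLCS := isCompleteLCS_punit
  leftContinuous := ⟨continuous_const⟩
  rightContinuous := ⟨continuous_const⟩

instance : Subsingleton zeroBimodule.carrier := inferInstanceAs (Subsingleton PUnit)

/-- The zero morphism. -/
def BimoduleHom.zero (M N : HatBimodule ℂ[X] ℂ[X]) :
    BimoduleHom ℂ[X] ℂ[X] M.carrier N.carrier where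
  toCLM := 0
  map_left a _ := (smul_zero a).symm
  map_right a _ := (smul_zero (MulOpposite.op a)).symm

theorem isProjective_zeroBimodule : IsProjective zeroBimodule := fun M N σ _ φ =>
  ⟨BimoduleHom.zero _ _, fun p => by
    rw [Subsingleton.elim p 0, map_zero, map_zero, map_zero]⟩

/-! ### The Koszul resolution of `ℂ[X]` and its contracting homotopy. -/

/-- The modules of the Koszul resolution of `ℂ[z]`. -/
def koszulModule : ℕ → HatBimodule ℂ[X] ℂ[X]
  | 0 => freeBimodule
  | 1 => freeBimodule
  | _ + 2 => zeroBimodule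

/-- The augmentation of the Koszul resolution. -/
def koszulAug : BimoduleHom ℂ[X] ℂ[X] freeBimodule.carrier ℂ[X] :=
  freeGen isHatAlgebra_polynomial.toIsCompleteLCS 1

/-- The morphism `p ⊗ q ↦ p z ⊗ q - p ⊗ z q`. -/
def koszulDiff : BimoduleHom ℂ[X] ℂ[X] freeBimodule.carrier freeBimodule.carrier :=
  freeGen freeBimodule.completeLCS (freeTmul X 1 - freeTmul 1 X)

/-- The differentials of the Koszul resolution. -/
def koszulD : ∀ n, BimoduleHom ℂ[X] ℂ[X] (koszulModule (n + 1)).carrier (koszulModule n).carrier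
  | 0 => koszulDiff
  | _ + 1 => BimoduleHom.zero _ _

/-- The section `q ↦ 1 ⊗ q` of the augmentation. -/
def koszulSection : ℂ[X] →ₗ[ℂ] freeBimodule.carrier := freeTmul 1

/-- The divided difference `zⁿ ⊗ q ↦ ∑ zⁱ ⊗ zⁿ⁻¹⁻ⁱ q`. -/
def koszulDivDiff : freeBimodule.carrier →ₗ[ℂ] freeBimodule.carrier :=
  freeLift ((basisMonomials ℂ).constr ℂ fun n =>
    ∑ i ∈ Finset.range n, (freeTmul (X ^ i)).comp (LinearMap.mulLeft ℂ (X ^ (n - 1 - i))))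

theorem koszulDivDiff_freeTmul (n : ℕ) (q : ℂ[X]) : koszulDivDiff (freeTmul (X ^ n) q) =
    ∑ i ∈ Finset.range n, freeTmul (X ^ i) (X ^ (n - 1 - i) * q) := by
  have h : (X ^ n : ℂ[X]) = basisMonomials ℂ n := by
    rw [coe_basisMonomials, X_pow_eq_monomial]
  rw [koszulDivDiff, freeLift_freeTmul, h, Module.Basis.constr_basis]
  simp [LinearMap.sum_apply]

/-- The contracting homotopy of the Koszul resolution. -/
def koszulHomotopy :
    ∀ n, (koszulModule n).carrier →ₗ[ℂ] (koszulModule (n + 1)).carrier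
  | 0 => koszulDivDiff
  | _ + 1 => 0

theorem koszulAug_freeTmul (p q : ℂ[X]) : koszulAug.toCLM (freeTmul p q) = p * q := by
  rw [koszulAug, freeGen_freeTmul]
  simp

theorem koszulDiff_freeTmul (p q : ℂ[X]) :
    koszulDiff.toCLM (freeTmul p q) = freeTmul (p * X) q - freeTmul p (X * q) := by
  rw [koszulDiff, freeGen_freeTmul, smul_sub, smul_sub, op_smul_freeTmul, op_smul_freeTmul,
    smul_freeTmul, smul_freeTmul, one_mul, mul_one]

theorem koszulAug_section (a : ℂ[X]) : koszulAug.toCLM (koszulSection a) = a := by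
  rw [koszulSection, koszulAug_freeTmul, one_mul]

theorem koszulAug_diff (y : freeBimodule.carrier) : koszulAug.toCLM (koszulDiff.toCLM y) = 0 := by
  induction y using free_induction with
  | h p q =>
    rw [koszulDiff_freeTmul, map_sub, koszulAug_freeTmul, koszulAug_freeTmul, mul_assoc, sub_self]
  | hadd x y hx hy => rw [map_add, map_add, hx, hy, add_zero]

theorem koszul_homotopy_zero (y : freeBimodule.carrier) :
    koszulSection (koszulAug.toCLM y) + koszulDiff.toCLM (koszulDivDiff y) = y := by
  have h : koszulSection.comp (koszulAug.toCLM : freeBimodule.carrier →ₗ[ℂ] ℂ[X]) +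
      (koszulDiff.toCLM : freeBimodule.carrier →ₗ[ℂ] freeBimodule.carrier).comp koszulDivDiff =
        LinearMap.id := by
    refine free_hom_ext fun n q => ?_
    simp only [LinearMap.add_apply, LinearMap.comp_apply, ContinuousLinearMap.coe_coe,
      koszulDivDiff_freeTmul, map_sum, koszulAug_freeTmul, koszulDiff_freeTmul, koszulSection,
      LinearMap.id_apply]
    -- With `uᵢ = zⁱ ⊗ zⁿ⁻ⁱ q` the summands are `uᵢ₊₁ - uᵢ`. The sum telescopes to `zⁿ ⊗ q - 1 ⊗ zⁿ
    -- q`, whose second term cancels the section of the augmentation.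
    have e : ∀ i ∈ Finset.range n, freeTmul (X ^ i * X) (X ^ (n - 1 - i) * q) -
        freeTmul (X ^ i) (X * (X ^ (n - 1 - i) * q)) =
        freeTmul (X ^ (i + 1)) (X ^ (n - (i + 1)) * q) - freeTmul (X ^ i) (X ^ (n - i) * q) :=
      fun i hi => by
        have hi := Finset.mem_range.1 hi
        rw [← pow_succ, ← mul_assoc, ← pow_succ', show n - 1 - i + 1 = n - i by omega,
          show n - 1 - i = n - (i + 1) by omega]
    rw [Finset.sum_congr rfl e,
      Finset.sum_range_sub (fun i => freeTmul (X ^ i) (X ^ (n - i) * q))]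
    simp
  exact LinearMap.congr_fun h y

theorem koszul_homotopy_one (y : freeBimodule.carrier) :
    koszulDivDiff (koszulDiff.toCLM y) = y := by
  have h : koszulDivDiff.comp
      (koszulDiff.toCLM : freeBimodule.carrier →ₗ[ℂ] freeBimodule.carrier) = LinearMap.id := by
    refine free_hom_ext fun n q => ?_
    simp only [LinearMap.comp_apply, ContinuousLinearMap.coe_coe, koszulDiff_freeTmul, map_sub,
      LinearMap.id_apply, ← pow_succ, koszulDivDiff_freeTmul]
    -- The divided differences of `zⁿ⁺¹ ⊗ q` and `zⁿ ⊗ zq` share their terms with `i < n`; only `zⁿ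
    -- ⊗ q` is left.
    have e : ∀ i ∈ Finset.range n, freeTmul (X ^ i) (X ^ (n + 1 - 1 - i) * q) =
        freeTmul (X ^ i) (X ^ (n - 1 - i) * (X * q)) := fun i hi => by
      have hi := Finset.mem_range.1 hi
      rw [← mul_assoc, ← pow_succ, show n + 1 - 1 - i = n - 1 - i + 1 by omega]
    rw [Finset.sum_range_succ, Finset.sum_congr rfl e, add_sub_cancel_left]
    simp
  exact LinearMap.congr_fun h y

theorem koszul_homotopy : ∀ (n : ℕ) (y : (koszulModule (n + 1)).carrier),
    koszulHomotopy n ((koszulD n).toCLM y) + (koszulD (n + 1)).toCLM (koszulHomotopy (n + 1) y) = y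
  | 0, y => by
    have h : (koszulD 1).toCLM (koszulHomotopy 1 y) = 0 := map_zero _
    rw [h, add_zero]
    exact koszul_homotopy_one y
  | _ + 1, _ => Subsingleton.elim (α := zeroBimodule.carrier) _ _

theorem continuous_koszulHomotopy : ∀ n, Continuous (koszulHomotopy n)
  | 0 => isFinest_freeBimodule.continuous_linearMap freeBimodule.completeLCS _
  | _ + 1 => continuous_const

/-- The Koszul resolution of `ℂ[z]`. -/
def koszulResolution : ProjResolution ℂ[X] where
  P := koszulModule
  projective
    | 0 => isProjective_freeBimodule
    | 1 => isProjective_freeBimodule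
    | _ + 2 => isProjective_zeroBimodule
  ε := koszulAug
  d := koszulD
  split := ⟨koszulAug_diff, fun _ _ => map_zero _,
    ⟨koszulSection, isFinest_polynomial.continuous_linearMap freeBimodule.completeLCS _⟩,
    fun n => ⟨koszulHomotopy n, continuous_koszulHomotopy n⟩,
    koszulAug_section, koszul_homotopy_zero, koszul_homotopy⟩

end FreeBimodule

/-! ### Extension by continuity from a dense range. -/

section Extension

/-- Extension by continuity along a linear map `D` with dense range, of a linear map that is
continuous for the topology induced by `D`. -/
theorem exists_continuousLinearMap_extension {V E F : Type*} [AddCommGroup V] [Module ℂ V]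
    [AddCommGroup E] [Module ℂ E] [UniformSpace E] [IsUniformAddGroup E] [ContinuousConstSMul ℂ E]
    [AddCommGroup F] [Module ℂ F] [UniformSpace F] [IsUniformAddGroup F] [ContinuousConstSMul ℂ F]
    [CompleteSpace F] [T0Space F] (D : V →ₗ[ℂ] E) (hD : DenseRange D) (g : V →ₗ[ℂ] F)
    (hg : Tendsto g (comap D (𝓝 0)) (𝓝 0)) :
    ∃ G : E →L[ℂ] F, ∀ v, G (D v) = g v := by
  -- The domain carries the uniformity induced by `D`, in general not separated.
  let _ : UniformSpace V := UniformSpace.comap D inferInstance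
  have : IsUniformAddGroup V := IsUniformAddGroup.comap D
  have hD' : IsUniformInducing D := ⟨rfl⟩
  have hg' : Continuous g := by
    refine continuous_of_continuousAt_zero g ?_
    rw [ContinuousAt, map_zero, hD'.isInducing.nhds_eq_comap, map_zero]
    exact hg
  exact ⟨ContinuousLinearMap.extend ⟨g, hg'⟩ ⟨D, hD'.uniformContinuous.continuous⟩,
    ContinuousLinearMap.extend_eq ⟨g, hg'⟩ (e := ⟨D, hD'.uniformContinuous.continuous⟩) hD hD'⟩

end Extension

/-! ### Base change of bimodules along a homomorphism with dense range. -/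

section BaseChange

variable {A B : Type u} [Ring A] [Algebra ℂ A] [Ring B] [Algebra ℂ B] (f : A →ₐ[ℂ] B)
  (M : Type u) [AddCommGroup M] [Module ℂ M] [Module A M] [Module Aᵐᵒᵖ M]

/-- The quotient map onto `B ⊗_A M ⊗_A B`. -/
def AlgBaseChange.mk : B ⊗[ℂ] (M ⊗[ℂ] B) →ₗ[ℂ] AlgBaseChange f M := (balancing f M).mkQ

/-- The canonical trilinear map `B × M × B → B ⊗_A M ⊗_A B`. -/
def AlgBaseChange.tmulLinear : B →ₗ[ℂ] M →ₗ[ℂ] B →ₗ[ℂ] AlgBaseChange f M where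
  toFun b := (TensorProduct.mk ℂ M B).compr₂ (AlgBaseChange.mk f M ∘ₗ TensorProduct.mk ℂ B _ b)
  map_add' b b' := by ext; simp
  map_smul' c b := by ext; simp

theorem AlgBaseChange.tmulLinear_apply (b : B) (m : M) (c : B) :
    AlgBaseChange.tmulLinear f M b m c = AlgBaseChange.tmul f M b m c := rfl

variable {M}

theorem AlgBaseChange.tmul_smul_left (a : A) (b : B) (m : M) (c : B) :
    AlgBaseChange.tmul f M b (a • m) c = AlgBaseChange.tmul f M (b * f a) m c :=
  ((Submodule.Quotient.eq (balancing f M)).2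
    (Submodule.subset_span (Or.inl ⟨a, b, c, m, rfl⟩))).symm

theorem AlgBaseChange.tmul_smul_right (a : A) (b : B) (m : M) (c : B) :
    AlgBaseChange.tmul f M b (MulOpposite.op a • m) c = AlgBaseChange.tmul f M b m (f a * c) :=
  (Submodule.Quotient.eq (balancing f M)).2 (Submodule.subset_span (Or.inr ⟨a, b, c, m, rfl⟩))

theorem AlgBaseChange.induction {C : AlgBaseChange f M → Prop} (x : AlgBaseChange f M)
    (h : ∀ b m c, C (AlgBaseChange.tmul f M b m c)) (hadd : ∀ x y, C x → C y → C (x + y)) :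
    C x := by
  have h0 : C 0 := by
    have := h 0 0 0
    rwa [← AlgBaseChange.tmulLinear_apply, map_zero] at this
  obtain ⟨t, rfl⟩ : ∃ t, AlgBaseChange.mk f M t = x := (balancing f M).mkQ_surjective x
  induction t with
  | zero => rwa [map_zero]
  | add x y hx hy => rw [map_add]; exact hadd _ _ hx hy
  | tmul b s =>
    induction s with
    | zero => rwa [TensorProduct.tmul_zero, map_zero]
    | add x y hx hy => rw [TensorProduct.tmul_add, map_add]; exact hadd _ _ hx hy
    | tmul m c => exact h b m c

/-- The linear map on `B ⊗_A M ⊗_A B` defined by a balanced trilinear map. -/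
def AlgBaseChange.lift {G : Type*} [AddCommGroup G] [Module ℂ G]
    (τ : B →ₗ[ℂ] M →ₗ[ℂ] B →ₗ[ℂ] G)
    (hl : ∀ a b m c, τ (b * f a) m c = τ b (a • m) c)
    (hr : ∀ a b m c, τ b (MulOpposite.op a • m) c = τ b m (f a * c)) :
    AlgBaseChange f M →ₗ[ℂ] G :=
  (balancing f M).liftQ
    (TensorProduct.lift ((TensorProduct.lift.equiv (RingHom.id ℂ) M B G).toLinearMap ∘ₗ τ)) <| by
      refine Submodule.span_le.2 ?_
      rintro t (⟨a, b, c, m, rfl⟩ | ⟨a, b, c, m, rfl⟩)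
      · simp [hl]
      · simp [hr]

variable (M) in
/-- The map `m ↦ 1 ⊗ m ⊗ 1`. -/
def AlgBaseChange.unit : M →ₗ[ℂ] AlgBaseChange f M :=
  (AlgBaseChange.tmulLinear f M 1).flip 1

theorem AlgBaseChange.unit_apply (m : M) :
    AlgBaseChange.unit f M m = AlgBaseChange.tmul f M 1 m 1 := rfl

section Topology

variable [TopologicalSpace B] [TopologicalSpace M]

/-- The defining seminorms are only known to be continuous after composition with the trilinear map.
The increment splits into three values of that map, each vanishing at the base point. -/
theorem AlgBaseChange.continuous_tmul [IsTopologicalAddGroup B] [IsTopologicalAddGroup M] :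
    Continuous fun x : B × M × B => AlgBaseChange.tmul f M x.1 x.2.1 x.2.2 := by
  rw [continuous_iff_continuousAt]
  rintro ⟨b, m, c⟩
  refine ((AlgBaseChange.withSeminorms f M).tendsto_nhds _ _).2 fun q ε hε => ?_
  have hc : Continuous fun x : B × M × B =>
      q.1 (AlgBaseChange.tmul f M (x.1 - b) x.2.1 x.2.2) +
        (q.1 (AlgBaseChange.tmul f M b (x.2.1 - m) x.2.2) +
          q.1 (AlgBaseChange.tmul f M b m (x.2.2 - c))) := by
    refine (q.2.comp (f := fun x : B × M × B => (x.1 - b, x.2.1, x.2.2)) (by fun_prop)).add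
      ((q.2.comp (f := fun x : B × M × B => (b, x.2.1 - m, x.2.2)) (by fun_prop)).add
        (q.2.comp (f := fun x : B × M × B => (b, m, x.2.2 - c)) (by fun_prop)))
  have ht := hc.tendsto (b, m, c)
  simp only [← AlgBaseChange.tmulLinear_apply, sub_self, map_zero, LinearMap.zero_apply,
    add_zero] at ht
  filter_upwards [ht.eventually (gt_mem_nhds hε)] with x hx
  refine lt_of_le_of_lt ?_ hx
  have e : AlgBaseChange.tmul f M x.1 x.2.1 x.2.2 - AlgBaseChange.tmul f M b m c =
      AlgBaseChange.tmulLinear f M (x.1 - b) x.2.1 x.2.2 +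
        (AlgBaseChange.tmulLinear f M b (x.2.1 - m) x.2.2 +
          AlgBaseChange.tmulLinear f M b m (x.2.2 - c)) := by
    simp [← AlgBaseChange.tmulLinear_apply]
  rw [e]
  exact (map_add_le_add _ _ _).trans (add_le_add_right (map_add_le_add _ _ _) _)

variable (M) in
theorem AlgBaseChange.denseRange_unit [IsTopologicalAddGroup B] [IsTopologicalAddGroup M]
    (hf : DenseRange f) : DenseRange (AlgBaseChange.unit f M) := by
  intro x
  have hcl : closure (Set.range (AlgBaseChange.unit f M)) =
      (LinearMap.range (AlgBaseChange.unit f M)).topologicalClosure := by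
    rw [Submodule.topologicalClosure_coe, LinearMap.coe_range]
  rw [hcl]
  induction x using AlgBaseChange.induction with
  | hadd x y hx hy => exact Submodule.add_mem _ hx hy
  | h b m c =>
    rw [← hcl]
    have hcont : Continuous fun x : B × B => AlgBaseChange.tmul f M x.1 m x.2 :=
      (AlgBaseChange.continuous_tmul f).comp
        (continuous_fst.prodMk (continuous_const.prodMk continuous_snd))
    -- By density of `f` in both outer factors it suffices to treat `f a ⊗ m ⊗ f a'`, which equals
    -- `1 ⊗ a m a' ⊗ 1`.
    have hd : DenseRange (Prod.map f f) := hf.prodMap hf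
    refine hd.induction_on (p := fun x : B × B => AlgBaseChange.tmul f M x.1 m x.2 ∈
      closure (Set.range (AlgBaseChange.unit f M))) (b, c) (isClosed_closure.preimage hcont) ?_
    rintro ⟨a, a'⟩
    refine subset_closure ⟨a • MulOpposite.op a' • m, ?_⟩
    rw [AlgBaseChange.unit_apply, AlgBaseChange.tmul_smul_left, AlgBaseChange.tmul_smul_right,
      one_mul, mul_one]
    rfl

variable (M) in
/-- The map `m ↦ 1 ⊗ m ⊗ 1` to the complete tensor product. -/
def BaseChange.unit : M →ₗ[ℂ] BaseChange f M where
  toFun m := (AlgBaseChange.unit f M m : BaseChange f M)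
  map_add' m m' := by rw [map_add, UniformSpace.Completion.coe_add]
  map_smul' c m := by rw [map_smul, UniformSpace.Completion.coe_smul, RingHom.id_apply]

theorem BaseChange.unit_apply (m : M) :
    BaseChange.unit f M m = (AlgBaseChange.unit f M m : BaseChange f M) := rfl

variable (M) in
theorem BaseChange.denseRange_unit [IsTopologicalAddGroup B] [IsTopologicalAddGroup M]
    (hf : DenseRange f) : DenseRange (BaseChange.unit f M) :=
  UniformSpace.Completion.denseRange_coe.comp (AlgBaseChange.denseRange_unit f M hf)
    (UniformSpace.Completion.continuous_coe _)

variable {N : Type u} [AddCommGroup N] [Module ℂ N] [Module A N] [Module Aᵐᵒᵖ N]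
  [TopologicalSpace N]

theorem BaseChange.map_unit (φ : BimoduleHom A A M N) (m : M) :
    BaseChange.map f φ (BaseChange.unit f M m) = BaseChange.unit f N (φ.toCLM m) :=
  UniformSpace.Completion.map_coe
    (uniformContinuous_addMonoidHom_of_continuous
      (f := (AlgBaseChange.mapLinear f φ).toAddMonoidHom)
      (AlgBaseChange.continuous_mapLinear f φ)) _

/-- Every projective seminorm of `1 ⊗ k m ⊗ 1` is bounded by a projective seminorm of
`1 ⊗ m ⊗ 1`. -/
def IsBaseChangeBounded (k : M →ₗ[ℂ] N) : Prop :=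
  ∀ q : AlgBaseChange.ProjSeminorm f N, ∃ p : AlgBaseChange.ProjSeminorm f M,
    ∀ m, q.1 (AlgBaseChange.unit f N (k m)) ≤ p.1 (AlgBaseChange.unit f M m)

theorem IsBaseChangeBounded.exists_extension [IsTopologicalAddGroup B] [IsTopologicalAddGroup M]
    (hf : DenseRange f) {k : M →ₗ[ℂ] N} (hk : IsBaseChangeBounded f k) :
    ∃ K : BaseChange f M →L[ℂ] BaseChange f N,
      ∀ m, K (BaseChange.unit f M m) = BaseChange.unit f N (k m) := by
  refine exists_continuousLinearMap_extension (BaseChange.unit f M)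
    (BaseChange.denseRange_unit f M hf) (BaseChange.unit f N ∘ₗ k) ?_
  -- The completion map is inducing, so the topology induced on `M` can be computed before
  -- completion, where projective seminorms describe it.
  have h1 : comap (BaseChange.unit f M) (𝓝 0) = comap (AlgBaseChange.unit f M) (𝓝 0) := by
    have : (BaseChange.unit f M : M → BaseChange f M) =
      (fun x : AlgBaseChange f M => (x : BaseChange f M)) ∘
      AlgBaseChange.unit f M := rfl
    rw [this, ← comap_comap, (UniformSpace.Completion.isUniformInducing_coe
      (AlgBaseChange f M)).isInducing.nhds_eq_comap, UniformSpace.Completion.coe_zero]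
  have h2 : Tendsto (AlgBaseChange.unit f N ∘ₗ k) (comap (AlgBaseChange.unit f M) (𝓝 0))
      (𝓝 0) := by
    refine ((AlgBaseChange.withSeminorms f N).tendsto_nhds _ _).2 fun q ε hε => ?_
    obtain ⟨p, hp⟩ := hk q
    have h3 := ((AlgBaseChange.withSeminorms f M).tendsto_nhds id 0).1 tendsto_id p ε hε
    filter_upwards [h3.comap (AlgBaseChange.unit f M)] with m hm
    rw [sub_zero] at hm ⊢
    exact (hp m).trans_lt hm
  rw [h1]
  have h4 := ((UniformSpace.Completion.continuous_coe (AlgBaseChange f N)).tendsto 0).comp h2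
  rwa [UniformSpace.Completion.coe_zero] at h4

theorem isBaseChangeBounded_zero : IsBaseChangeBounded f (0 : M →ₗ[ℂ] N) := fun q =>
  ⟨⟨0, by simpa using continuous_const⟩, fun m => by simp⟩

end Topology

end BaseChange

/-- The base change of a resolution is admissible if the contracting homotopy extends to the base
change. -/
theorem isSplitComplex_baseChange {A B : Type u} [Ring A] [Algebra ℂ A] [TopologicalSpace A]
    [Ring B] [Algebra ℂ B] [TopologicalSpace B] (hA : IsCompleteLCS A) (hB : IsCompleteLCS B)
    (f : A →ₐ[ℂ] B) (hf : DenseRange f) (R : ProjResolution A)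
    (h : A →ₗ[ℂ] (R.P 0).carrier) (k : ∀ n, (R.P n).carrier →ₗ[ℂ] (R.P (n + 1)).carrier)
    (hh : ∀ x, R.ε.toCLM (h x) = x)
    (hk0 : ∀ y, h (R.ε.toCLM y) + (R.d 0).toCLM (k 0 y) = y)
    (hk : ∀ n y, k n ((R.d n).toCLM y) + (R.d (n + 1)).toCLM (k (n + 1) y) = y)
    (hb : IsBaseChangeBounded f h) (kb : ∀ n, IsBaseChangeBounded f (k n)) :
    IsSplitComplex (Y := fun n => BaseChange f (R.P n).carrier)
      (BaseChange.map f R.ε) (fun n => BaseChange.map f (R.d n)) := by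
  have := hA.isTopologicalAddGroup
  have := hB.isTopologicalAddGroup
  have hP : ∀ n, IsTopologicalAddGroup (R.P n).carrier := fun n =>
    (R.P n).completeLCS.isTopologicalAddGroup
  have hd : ∀ n, DenseRange (BaseChange.unit f (R.P n).carrier) := fun n =>
    BaseChange.denseRange_unit f _ hf
  obtain ⟨H, hH⟩ := hb.exists_extension f hf
  choose K hK using fun n => (kb n).exists_extension f hf
  refine ⟨fun y => ?_, fun n y => ?_, H, K, fun x => ?_, fun y => ?_, fun n y => ?_⟩
  -- Each identity equates continuous maps, so it is checked on the dense set of elements `1 ⊗ m ⊗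
  -- 1`, where it reduces to the identity in the original resolution.
  · refine (hd 1).induction_on y (isClosed_eq (by fun_prop) continuous_const) fun m => ?_
    rw [BaseChange.map_unit, BaseChange.map_unit, R.split.1, map_zero]
  · refine (hd (n + 2)).induction_on y (isClosed_eq (by fun_prop) continuous_const) fun m => ?_
    rw [BaseChange.map_unit, BaseChange.map_unit, R.split.2.1, map_zero]
  · refine (BaseChange.denseRange_unit f A hf).induction_on x
      (isClosed_eq (by fun_prop) continuous_id) fun m => ?_
    rw [hH, BaseChange.map_unit, hh]
  · refine (hd 0).induction_on y (isClosed_eq (by fun_prop) continuous_id) fun m => ?_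
    rw [BaseChange.map_unit, hH, hK, BaseChange.map_unit, ← map_add, hk0]
  · refine (hd (n + 1)).induction_on y (isClosed_eq (by fun_prop) continuous_id) fun m => ?_
    rw [BaseChange.map_unit, hK, hK, BaseChange.map_unit, ← map_add, hk]

theorem basisSeminorm_mul_left {ι : Type*} {E : Type u} [AddCommGroup E] [Module ℂ E]
    (b : Module.Basis ι ℂ E) (r : ℝ≥0) (w : ι → ℝ≥0) (x : E) :
    basisSeminorm b (fun i => r * w i) x = r * basisSeminorm b w x := by
  rw [basisSeminorm_apply, basisSeminorm_apply, ← tsum_mul_left]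
  exact tsum_congr fun j => by push_cast; ring

/-! ### Weighted power series algebras and boundedness of the Koszul homotopy. -/

section Completion

open Polynomial

variable {B : Type} [CommRing B] [Algebra ℂ B]

/-- Both polynomial factors move into the outer copies of `B`: the base change of the free bimodule
is algebraically `B ⊗ B`. -/
theorem tmul_freeTmul (f : ℂ[X] →ₐ[ℂ] B) (a b : B) (x y : ℂ[X]) :
    AlgBaseChange.tmul f freeBimodule.carrier a (freeTmul x y) b =
      AlgBaseChange.tmul f freeBimodule.carrier (a * f x) (freeTmul 1 1) (f y * b) := by
  rw [← AlgBaseChange.tmul_smul_right, ← AlgBaseChange.tmul_smul_left, op_smul_freeTmul,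
    smul_freeTmul, one_mul, mul_one]

theorem free_hom_ext' {G : Type*} [AddCommGroup G] [Module ℂ G]
    {φ ψ : freeBimodule.carrier →ₗ[ℂ] G} (h : ∀ x y, φ (freeTmul x y) = ψ (freeTmul x y)) :
    φ = ψ :=
  free_hom_ext fun _ _ => h _ _

/-- The trilinear map `(a, x ⊗ y, b) ↦ cₙ(a x) y b`. -/
def coeffTrilinear (f : ℂ[X] →ₐ[ℂ] B) (c : B →ₗ[ℂ] (ℕ → ℂ)) (n : ℕ) :
    B →ₗ[ℂ] freeBimodule.carrier →ₗ[ℂ] B →ₗ[ℂ] B where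
  toFun a := freeLift (LinearMap.mk₂ ℂ (fun x y => c (a * f x) n • LinearMap.mulLeft ℂ (f y))
    (fun x x' y => by rw [map_add, mul_add, map_add, Pi.add_apply, add_smul])
    (fun t x y => by
      rw [map_smul, mul_smul_comm, map_smul, Pi.smul_apply, smul_eq_mul, mul_smul])
    (fun x y y' => by ext; simp [add_mul])
    (fun t x y => by ext; simp [smul_comm t]))
  map_add' a a' := free_hom_ext' fun x y => by simp [add_mul, add_smul]
  map_smul' t a := free_hom_ext' fun x y => by simp [mul_smul]

theorem coeffTrilinear_apply (f : ℂ[X] →ₐ[ℂ] B) (c : B →ₗ[ℂ] (ℕ → ℂ)) (n : ℕ) (a b : B)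
    (x y : ℂ[X]) : coeffTrilinear f c n a (freeTmul x y) b = c (a * f x) n • (f y * b) := by
  simp [coeffTrilinear]

/-- The linear map `a ⊗ (x ⊗ y) ⊗ b ↦ cₙ(a x) y b`. -/
def coeffLinear (f : ℂ[X] →ₐ[ℂ] B) (c : B →ₗ[ℂ] (ℕ → ℂ)) (n : ℕ) :
    AlgBaseChange f freeBimodule.carrier →ₗ[ℂ] B :=
  AlgBaseChange.lift f (coeffTrilinear f c n)
    (fun a b m d => by
      induction m using free_induction with
      | h x y =>
        rw [smul_freeTmul, coeffTrilinear_apply, coeffTrilinear_apply, map_mul f, mul_assoc]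
      | hadd x y hx hy => rw [smul_add, map_add, map_add, LinearMap.add_apply,
          LinearMap.add_apply, hx, hy])
    (fun a b m d => by
      induction m using free_induction with
      | h x y =>
        rw [op_smul_freeTmul, coeffTrilinear_apply, coeffTrilinear_apply, map_mul f, mul_assoc]
      | hadd x y hx hy => rw [smul_add, map_add, map_add, LinearMap.add_apply,
          LinearMap.add_apply, hx, hy])

theorem coeffLinear_tmul (f : ℂ[X] →ₐ[ℂ] B) (c : B →ₗ[ℂ] (ℕ → ℂ)) (n : ℕ) (a b : B)
    (x y : ℂ[X]) : coeffLinear f c n (AlgBaseChange.tmul f _ a (freeTmul x y) b) =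
      c (a * f x) n • (f y * b) :=
  coeffTrilinear_apply f c n a b x y

variable [TopologicalSpace B] {κ : Type*}

/-- `B` is an algebra of formal power series, defined by the weights `W k`, containing the
polynomials. -/
structure IsWeightedPowerAlgebra (f : ℂ[X] →ₐ[ℂ] B) (c : B →ₗ[ℂ] (ℕ → ℂ)) (W : κ → ℕ → ℝ)
    (p : SeminormFamily ℂ B κ) : Prop extends IsKoethe c W p where
  coeff_map : ∀ q n, c (f q) n = q.coeff n
  coeff_mul : ∀ a b n, c (a * b) n = ∑ x ∈ Finset.HasAntidiagonal.antidiagonal n, c a x.1 * c b x.2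
  directed : ∀ k l, ∃ m, (∀ n, W k n ≤ W m n) ∧ ∀ n, W l n ≤ W m n
  -- Submultiplicative weights give submultiplicative seminorms.
  weight_add_le : ∀ k m n, W k (m + n) ≤ W k m * W k n
  -- This controls the divided difference, whose value on `zⁿ ⊗ 1` is the sum of the `zⁱ ⊗ zⁿ⁻¹⁻ⁱ`
  -- with `i < n`.
  sum_weight_le : ∀ k, ∃ (C : ℝ) (l : κ), 0 ≤ C ∧
    ∀ n, ∑ i ∈ Finset.range n, W k i * W k (n - 1 - i) ≤ C * W l n

namespace IsWeightedPowerAlgebra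

variable {f : ℂ[X] →ₐ[ℂ] B} {c : B →ₗ[ℂ] (ℕ → ℂ)} {W : κ → ℕ → ℝ} {p : SeminormFamily ℂ B κ}

theorem seminorm_mul_le (h : IsWeightedPowerAlgebra f c W p) (k : κ) (a b : B) :
    p k (a * b) ≤ p k a * p k b := by
  have ha := h.hasSum k a
  have hb := h.hasSum k b
  have h0 : ∀ (x : B) n, 0 ≤ ‖c x n‖ * W k n := fun x n =>
    mul_nonneg (norm_nonneg _) (h.nonneg k n)
  have hab := ha.summable.mul_of_nonneg hb.summable (h0 a) (h0 b)
  rw [← ha.tsum_eq, ← hb.tsum_eq, ← (h.hasSum k (a * b)).tsum_eq,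
    Summable.tsum_mul_tsum_eq_tsum_sum_antidiagonal (A := ℕ) ha.summable hb.summable hab]
  refine (h.hasSum k (a * b)).summable.tsum_le_tsum (fun n => ?_)
    (summable_sum_mul_antidiagonal_of_summable_mul (A := ℕ)
      (f := fun n => ‖c a n‖ * W k n) (g := fun n => ‖c b n‖ * W k n) hab)
  rw [h.coeff_mul]
  refine (mul_le_mul_of_nonneg_right (norm_sum_le _ _) (h.nonneg k n)).trans ?_
  rw [Finset.sum_mul]
  refine Finset.sum_le_sum fun x hx => ?_
  rw [← Finset.HasAntidiagonal.mem_antidiagonal.1 hx, norm_mul, mul_mul_mul_comm]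
  exact mul_le_mul_of_nonneg_left (h.weight_add_le k _ _)
    (mul_nonneg (norm_nonneg _) (norm_nonneg _))

theorem seminorm_map_X_pow (h : IsWeightedPowerAlgebra f c W p) (k : κ) (n : ℕ) :
    p k (f (X ^ n)) = W k n := by
  refine (h.hasSum k _).unique ?_
  have := hasSum_single (f := fun i => ‖c (f (X ^ n)) i‖ * W k i) n fun i hi => by
    rw [h.coeff_map, coeff_X_pow, if_neg hi, norm_zero, zero_mul]
  rwa [h.coeff_map, coeff_X_pow, if_pos rfl, norm_one, one_mul] at this

theorem seminorm_mono (h : IsWeightedPowerAlgebra f c W p) {k l : κ} (hkl : ∀ n, W k n ≤ W l n)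
    (a : B) : p k a ≤ p l a :=
  hasSum_le (fun n => mul_le_mul_of_nonneg_left (hkl n) (norm_nonneg _)) (h.hasSum k a)
    (h.hasSum l a)

theorem exists_finset_sup_le (h : IsWeightedPowerAlgebra f c W p) (s : Finset κ) :
    ∃ k, ∀ a, s.sup p a ≤ p k a := by
  classical
  obtain ⟨k₀, -⟩ := h.pos 0
  induction s using Finset.induction_on with
  | empty => exact ⟨k₀, fun a => by simp⟩
  | insert l s _ ih =>
    obtain ⟨k, hk⟩ := ih
    obtain ⟨m, hm, hm'⟩ := h.directed k l
    refine ⟨m, fun a => ?_⟩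
    rw [Finset.sup_insert]
    exact sup_le (h.seminorm_mono hm' a) ((hk a).trans (h.seminorm_mono hm a))

theorem isHatAlgebra (h : IsWeightedPowerAlgebra f c W p) : IsHatAlgebra B where
  toIsCompleteLCS := h.isCompleteLCS
  continuous_mul := by
    have := h.isCompleteLCS.isTopologicalAddGroup
    exact continuous_bilinear_of_bound h.withSeminorms (LinearMap.mul ℂ B) fun k =>
      ⟨p k, p k, h.withSeminorms.continuous_seminorm k, h.withSeminorms.continuous_seminorm k,
        h.seminorm_mul_le k⟩

theorem continuous (h : IsWeightedPowerAlgebra f c W p) : Continuous f :=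
  isFinest_polynomial.continuous_linearMap h.isCompleteLCS f.toLinearMap

/-- Truncations converge: the seminorm of the error is the tail of a convergent series. -/
theorem denseRange (h : IsWeightedPowerAlgebra f c W p) : DenseRange f := fun b => by
  refine mem_closure_of_tendsto (b := atTop)
    (f := fun n => f (∑ i ∈ Finset.range n, monomial i (c b i))) ?_
    (Eventually.of_forall fun n => ⟨_, rfl⟩)
  refine (h.withSeminorms.tendsto_nhds _ _).2 fun k ε hε => ?_
  have ht := tendsto_sum_nat_add fun i => ‖c b i‖ * W k i
  filter_upwards [ht.eventually (gt_mem_nhds hε)] with n hn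
  refine lt_of_le_of_lt (le_of_eq ?_) hn
  have hs := (hasSum_nat_add_iff' n).2 (h.hasSum k
    (f (∑ i ∈ Finset.range n, monomial i (c b i)) - b))
  have hcoef : ∀ j, c (f (∑ i ∈ Finset.range n, monomial i (c b i)) - b) j =
      if j < n then 0 else - c b j := fun j => by
    rw [map_sub, Pi.sub_apply, h.coeff_map, finsetSum_coeff]
    simp only [coeff_monomial, Finset.sum_ite_eq', Finset.mem_range]
    split_ifs <;> simp
  have hz : ∑ i ∈ Finset.range n,
      ‖c (f (∑ i ∈ Finset.range n, monomial i (c b i)) - b) i‖ * W k i = 0 :=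
    Finset.sum_eq_zero fun i hi => by rw [hcoef, if_pos (Finset.mem_range.1 hi)]; simp
  rw [hz, sub_zero] at hs
  rw [← hs.tsum_eq]
  refine tsum_congr fun i => ?_
  rw [hcoef, if_neg (by omega), norm_neg]

theorem isHatEpi (h : IsWeightedPowerAlgebra f c W p) : IsHatEpi f := by
  intro C _ _ _ hC g g' hg hg' e
  have := hC.t2
  exact DFunLike.coe_injective (h.denseRange.equalizer hg hg'
    (funext fun x => AlgHom.congr_fun e x))

/-- Continuous seminorms on the base change of the free bimodule are bounded by products. -/
theorem exists_projSeminorm_le (h : IsWeightedPowerAlgebra f c W p)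
    (q : AlgBaseChange.ProjSeminorm f freeBimodule.carrier) (m : freeBimodule.carrier) :
    ∃ (C : ℝ) (k : κ), 0 ≤ C ∧
      ∀ a b, q.1 (AlgBaseChange.tmul f _ a m b) ≤ C * (p k a * p k b) := by
  have hc : Continuous fun x : B × B => q.1 (AlgBaseChange.tmul f _ x.1 m x.2) :=
    q.2.comp (f := fun x : B × B => (x.1, m, x.2)) (by fun_prop)
  have ht := hc.tendsto (0, 0)
  simp only [← AlgBaseChange.tmulLinear_apply, map_zero] at ht
  have h1 := ht.eventually (gt_mem_nhds one_pos)
  rw [nhds_prod_eq] at h1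
  obtain ⟨U, hU, V, hV, hUV⟩ := mem_prod_iff.1 h1
  obtain ⟨s, r, hr, hsr⟩ := (h.withSeminorms.mem_nhds_iff 0 _).1 (inter_mem hU hV)
  obtain ⟨k, hk⟩ := h.exists_finset_sup_le s
  refine ⟨r⁻¹ * r⁻¹, k, by positivity, fun a b => ?_⟩
  rw [show r⁻¹ * r⁻¹ * (p k a * p k b) = (r⁻¹ * p k a) * (r⁻¹ * p k b) by ring]
  -- Rescaling by numbers strictly above `r⁻¹ * p k a` and `r⁻¹ * p k b` moves `a` and `b` into the
  -- ball, and covers the case where a seminorm vanishes.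
  refine le_mul_of_forall_lt₀ fun x hx y hy => ?_
  have hmem : ∀ (z : ℝ) (d : B), r⁻¹ * p k d < z → 0 < z ∧ ((z⁻¹ : ℝ) : ℂ) • d ∈ U ∩ V :=
    fun z d hz => by
      have hz0 : 0 < z := lt_of_le_of_lt (mul_nonneg (by positivity) (apply_nonneg _ _)) hz
      have hz1 : ((z⁻¹ : ℝ) : ℂ) • d ∈ (s.sup p).ball 0 r := by
        rw [Seminorm.mem_ball_zero]
        refine lt_of_le_of_lt (hk (((z⁻¹ : ℝ) : ℂ) • d)) ?_
        rw [map_smul_eq_mul, Complex.norm_real, Real.norm_of_nonneg (by positivity),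
          inv_mul_lt_iff₀ hz0]
        rwa [inv_mul_lt_iff₀ hr, mul_comm] at hz
      exact ⟨hz0, hsr hz1⟩
  obtain ⟨hx0, hx⟩ := hmem x a hx
  obtain ⟨hy0, hy⟩ := hmem y b hy
  have h2 := hUV (Set.mk_mem_prod hx.1 hy.2)
  rw [Set.mem_ofPred_eq] at h2
  simp only [map_smul, LinearMap.smul_apply] at h2
  rw [map_smul_eq_mul,
    map_smul_eq_mul, Complex.norm_real, Real.norm_of_nonneg (by positivity), Complex.norm_real,
    Real.norm_of_nonneg (by positivity), inv_mul_lt_iff₀ hy0, inv_mul_lt_iff₀ hx0, mul_one] at h2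
  exact h2.le

theorem hasSum_coeffLinear_tmul (h : IsWeightedPowerAlgebra f c W p) (k : κ) (a b : B)
    (x y : ℂ[X]) :
    HasSum (fun n => W k n * p k (coeffLinear f c n (AlgBaseChange.tmul f _ a (freeTmul x y) b)))
      (p k (a * f x) * p k (f y * b)) := by
  refine ((h.hasSum k (a * f x)).mul_right (p k (f y * b))).congr_fun fun n => ?_
  rw [coeffLinear_tmul, map_smul_eq_mul]
  ring

theorem summable_coeffLinear (h : IsWeightedPowerAlgebra f c W p) (k : κ)
    (z : AlgBaseChange f freeBimodule.carrier) :
    Summable fun n => W k n * p k (coeffLinear f c n z) := by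
  have hadd : ∀ z z' : AlgBaseChange f freeBimodule.carrier,
      (Summable fun n => W k n * p k (coeffLinear f c n z)) →
      (Summable fun n => W k n * p k (coeffLinear f c n z')) →
      Summable fun n => W k n * p k (coeffLinear f c n (z + z')) := fun z z' hz hz' =>
    Summable.of_nonneg_of_le (fun n => mul_nonneg (h.nonneg k n) (apply_nonneg _ _))
      (fun n => by
        rw [← mul_add, map_add]
        exact mul_le_mul_of_nonneg_left (map_add_le_add _ _ _) (h.nonneg k n)) (hz.add hz')
  induction z using AlgBaseChange.induction with
  | hadd z z' hz hz' => exact hadd z z' hz hz'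
  | h a m b =>
    induction m using free_induction with
    | h x y => exact (h.hasSum_coeffLinear_tmul k a b x y).summable
    | hadd x y hx hy =>
      rw [← AlgBaseChange.tmulLinear_apply] at hx hy ⊢
      rw [map_add, LinearMap.add_apply]
      exact hadd _ _ hx hy

/-- The weighted `ℓ¹`-seminorm on the base change of the free bimodule. -/
def baseChangeSeminorm (h : IsWeightedPowerAlgebra f c W p) (k : κ) :
    Seminorm ℂ (AlgBaseChange f freeBimodule.carrier) :=
  Seminorm.of (fun z => ∑' n, W k n * p k (coeffLinear f c n z))
    (fun z z' => by
      rw [← (h.summable_coeffLinear k z).tsum_add (h.summable_coeffLinear k z')]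
      refine (h.summable_coeffLinear k _).tsum_le_tsum (fun n => ?_)
        ((h.summable_coeffLinear k z).add (h.summable_coeffLinear k z'))
      rw [← mul_add, map_add]
      exact mul_le_mul_of_nonneg_left (map_add_le_add _ _ _) (h.nonneg k n))
    (fun t z => by
      rw [← tsum_mul_left]
      exact tsum_congr fun n => by rw [map_smul, map_smul_eq_mul, mul_left_comm])

theorem baseChangeSeminorm_tmul (h : IsWeightedPowerAlgebra f c W p) (k : κ) (a b : B)
    (x y : ℂ[X]) :
    h.baseChangeSeminorm k (AlgBaseChange.tmul f _ a (freeTmul x y) b) =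
      p k (a * f x) * p k (f y * b) :=
  (h.hasSum_coeffLinear_tmul k a b x y).tsum_eq

/-- For fixed `a` and `b` the middle variable is compared with a basis seminorm, so only `zⁱ ⊗ zʲ`
matters; there submultiplicativity gives `p k a * W k i * W k j * p k b`. -/
theorem continuous_baseChangeSeminorm (h : IsWeightedPowerAlgebra f c W p) (k : κ) :
    Continuous fun x : B × freeBimodule.carrier × B =>
      h.baseChangeSeminorm k (AlgBaseChange.tmul f _ x.1 x.2.1 x.2.2) := by
  have := h.isCompleteLCS.isTopologicalAddGroup
  have := freeBimodule.completeLCS.isTopologicalAddGroup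
  let w : ℕ → ℝ≥0 := fun n => (W k n).toNNReal
  have hw : ∀ n, (w n : ℝ) = W k n := fun n => Real.coe_toNNReal _ (h.nonneg k n)
  let bas : Module.Basis (ℕ × ℕ) ℂ freeBimodule.carrier := FreeTensor.basis
  have hbas : ∀ i, bas i = freeTmul (X ^ i.1) (X ^ i.2) := fun i => by
    rw [X_pow_eq_monomial, X_pow_eq_monomial]
    exact ((basisMonomials ℂ).tensorProduct_apply (basisMonomials ℂ) i.1 i.2).trans (by simp; rfl)
  refine continuous_seminorm_trilinear_of_bound (h.baseChangeSeminorm k)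
    (AlgBaseChange.tmulLinear f _) (P := p k) (R := p k)
    (Q := basisSeminorm bas fun i => w i.1 * w i.2)
    (h.withSeminorms.continuous_seminorm k) (isFinest_freeBimodule.continuous _)
    (h.withSeminorms.continuous_seminorm k) fun a m b => ?_
  have hle := seminorm_le_basisSeminorm bas
    ((h.baseChangeSeminorm k).comp ((AlgBaseChange.tmulLinear f _ a).flip b))
    (fun i => ((p k a).toNNReal * (p k b).toNNReal) * (w i.1 * w i.2))
    (fun i => ?_) m
  · refine hle.trans_eq ?_
    rw [basisSeminorm_mul_left]
    push_cast
    rw [Real.coe_toNNReal _ (apply_nonneg _ _), Real.coe_toNNReal _ (apply_nonneg _ _)]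
    ring
  · push_cast
    rw [Real.coe_toNNReal _ (apply_nonneg _ _), Real.coe_toNNReal _ (apply_nonneg _ _), hw, hw]
    change h.baseChangeSeminorm k (AlgBaseChange.tmul f _ a (bas i) b) ≤
      p k a * p k b * (W k i.1 * W k i.2)
    rw [hbas, baseChangeSeminorm_tmul, mul_mul_mul_comm, mul_comm (p k b)]
    refine mul_le_mul ((h.seminorm_mul_le k _ _).trans_eq ?_)
      ((h.seminorm_mul_le k _ _).trans_eq ?_) (apply_nonneg _ _)
      (mul_nonneg (apply_nonneg _ _) (h.nonneg k _))
    · rw [h.seminorm_map_X_pow]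
    · rw [h.seminorm_map_X_pow]

/-- Since `1 ⊗ (1 ⊗ m) ⊗ 1 = 1 ⊗ (1 ⊗ 1) ⊗ f m`, the seminorm `q` of the image depends only on `f
m`, which the product map `μ : a ⊗ x ⊗ b ↦ a f(x) b` recovers. The bound is an equality. -/
theorem isBaseChangeBounded_section (h : IsWeightedPowerAlgebra f c W p) :
    IsBaseChangeBounded f koszulSection := fun q => by
  let μ : AlgBaseChange f ℂ[X] →ₗ[ℂ] B := AlgBaseChange.lift f
    ((LinearMap.mul ℂ B).compr₂ (LinearMap.mul ℂ B) |>.compl₂ f.toLinearMap)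
    (fun a b m d => by simp [mul_assoc])
    (fun a b m d => by simp [mul_assoc])
  have := h.isHatAlgebra
  refine ⟨⟨(q.1.comp (AlgBaseChange.tmulLinear f _ 1 (freeTmul 1 1))).comp μ, ?_⟩, fun m => ?_⟩
  · have hf := h.continuous
    exact q.2.comp (f := fun x : B × ℂ[X] × B => (1, freeTmul 1 1, x.1 * f x.2.1 * x.2.2))
      (by fun_prop)
  · refine le_of_eq ?_
    change q.1 (AlgBaseChange.tmul f _ 1 (freeTmul 1 m) 1) =
      q.1 (AlgBaseChange.tmul f _ 1 (freeTmul 1 1) (1 * f m * 1))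
    rw [tmul_freeTmul, map_one, one_mul, one_mul]

theorem exists_eq_sum_freeTmul (m : freeBimodule.carrier) :
    ∃ g : ℕ →₀ ℂ[X], m = g.sum fun n a => freeTmul (X ^ n) a := by
  refine ⟨TensorProduct.equivFinsuppOfBasisLeft (basisMonomials ℂ) m, ?_⟩
  refine ((TensorProduct.equivFinsuppOfBasisLeft (basisMonomials ℂ)).symm_apply_apply m).symm.trans
    ?_
  rw [TensorProduct.equivFinsuppOfBasisLeft_symm_apply]
  refine Finsupp.sum_congr fun n _ => ?_
  rw [X_pow_eq_monomial, coe_basisMonomials]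
  rfl

/-- The bound is proved on each `zⁿ ⊗ a` with the weight `W m n`. Summing is harmless because the
target seminorm is an `ℓ¹`-sum over the powers of `z` in the left factor. -/
theorem isBaseChangeBounded_divDiff (h : IsWeightedPowerAlgebra f c W p) :
    IsBaseChangeBounded f koszulDivDiff := fun q => by
  obtain ⟨C, k, hC, hq⟩ := h.exists_projSeminorm_le q (freeTmul 1 1)
  obtain ⟨D, l, hD, hW⟩ := h.sum_weight_le k
  obtain ⟨m, hkm, hlm⟩ := h.directed k l
  have hmono : ∀ (n : ℕ) (a : ℂ[X]), q.1 (AlgBaseChange.unit f _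
      (koszulDivDiff (freeTmul (X ^ n) a))) ≤ C * D * (W m n * p m (f a)) := fun n a => by
    rw [koszulDivDiff_freeTmul, map_sum]
    have h1 : ∀ i ∈ Finset.range n,
        q.1 (AlgBaseChange.unit f _ (freeTmul (X ^ i) (X ^ (n - 1 - i) * a))) ≤
          C * p k (f a) * (W k i * W k (n - 1 - i)) := fun i _ => by
      rw [AlgBaseChange.unit_apply, tmul_freeTmul, one_mul, mul_one, map_mul]
      refine (hq _ _).trans ?_
      rw [mul_assoc C]
      refine mul_le_mul_of_nonneg_left ?_ hC
      rw [h.seminorm_map_X_pow, mul_left_comm]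
      refine mul_le_mul_of_nonneg_left ?_ (h.nonneg k i)
      rw [mul_comm (p k (f a))]
      exact (h.seminorm_mul_le k _ _).trans_eq (by rw [h.seminorm_map_X_pow])
    refine (Finset.le_sum_of_subadditive q.1 (map_zero q.1).le (map_add_le_add q.1) _ _).trans ?_
    refine (Finset.sum_le_sum h1).trans ?_
    rw [← Finset.mul_sum]
    have h2 := (hW n).trans (mul_le_mul_of_nonneg_left (hlm n) hD)
    have h3 := h.seminorm_mono hkm (f a)
    calc C * p k (f a) * _ ≤ C * p m (f a) * (D * W m n) :=
          mul_le_mul (mul_le_mul_of_nonneg_left h3 hC) h2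
            (Finset.sum_nonneg fun i _ => mul_nonneg (h.nonneg k _) (h.nonneg k _))
            (mul_nonneg hC (apply_nonneg _ _))
      _ = _ := by ring
  refine ⟨⟨(C * D).toNNReal • h.baseChangeSeminorm m, ?_⟩, fun x => ?_⟩
  · exact continuous_const.mul (h.continuous_baseChangeSeminorm m)
  · change _ ≤ ((C * D).toNNReal : ℝ) * h.baseChangeSeminorm m (AlgBaseChange.unit f _ x)
    rw [Real.coe_toNNReal _ (mul_nonneg hC hD)]
    obtain ⟨g, hg⟩ := exists_eq_sum_freeTmul x
    -- The functional `coeffLinear` reads off the right-hand coefficient of `zⁿ`, so the seminorm of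
    -- `x` is the weighted sum of the `p m (f (g n))`.
    have hcoef : ∀ n, coeffLinear f c n (AlgBaseChange.unit f _ x) = f (g n) := fun n => by
      rw [hg, Finsupp.sum, map_sum, map_sum, Finset.sum_eq_single n]
      · rw [AlgBaseChange.unit_apply, coeffLinear_tmul, one_mul, mul_one, h.coeff_map, coeff_X_pow,
          if_pos rfl, one_smul]
      · intro i _ hi
        rw [AlgBaseChange.unit_apply, coeffLinear_tmul, one_mul, h.coeff_map, coeff_X_pow,
          if_neg hi.symm, zero_smul]
      · intro hn
        rw [Finsupp.notMem_support_iff.1 hn, map_zero, map_zero, map_zero]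
    have hsum := (h.summable_coeffLinear m (AlgBaseChange.unit f _ x)).sum_le_tsum g.support
      fun n _ => mul_nonneg (h.nonneg m n) (apply_nonneg _ _)
    refine le_trans ?_ (mul_le_mul_of_nonneg_left hsum (mul_nonneg hC hD))
    simp only [hcoef]
    rw [Finset.mul_sum]
    conv_lhs => rw [hg, Finsupp.sum, map_sum, map_sum]
    exact (Finset.le_sum_of_subadditive q.1 (map_zero q.1).le (map_add_le_add q.1) _ _).trans
      (Finset.sum_le_sum fun n _ => hmono n (g n))

/-- The embedding of the polynomial algebra in a weighted power series algebra is a homological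
epimorphism. -/
theorem isHomologicalEpi (h : IsWeightedPowerAlgebra f c W p) : IsHomologicalEpi f where
  source := isHatAlgebra_polynomial
  target := h.isHatAlgebra
  continuous := h.continuous
  epi := h.isHatEpi
  acyclic := ⟨koszulResolution, isSplitComplex_baseChange isFinest_polynomial.isCompleteLCS
    h.isCompleteLCS f h.denseRange koszulResolution koszulSection koszulHomotopy
    koszulAug_section koszul_homotopy_zero koszul_homotopy h.isBaseChangeBounded_section fun n =>
      match n with
      | 0 => h.isBaseChangeBounded_divDiff
      | _ + 1 => isBaseChangeBounded_zero f⟩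

end IsWeightedPowerAlgebra

end Completion

/-! ### The algebras `𝔄_s` for finite `s`: factorial weights. -/

section FiniteOrder

/-- The coefficients of an element of `𝔄_s`. -/
def PowerAlgebra.coeff (s : ℝ≥0) : PowerAlgebra s →ₗ[ℂ] (ℕ → ℂ) :=
  LinearMap.pi fun n => (PowerSeries.coeff n).comp (PowerAlgebra.val s).toLinearMap

theorem PowerAlgebra.coeff_apply (s : ℝ≥0) (a : PowerAlgebra s) (n : ℕ) :
    PowerAlgebra.coeff s a n = PowerSeries.coeff n (PowerAlgebra.val s a) := rfl

theorem weight_mono (s : ℝ≥0) {r r' : ℝ} (hr : 0 < r) (h : r ≤ r') (n : ℕ) :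
    weight s r n ≤ weight s r' n := by
  unfold weight
  gcongr

/-- The quotient is `n * (n - 1).choose i`, and each factor is at most `2 ^ n`. -/
theorem factorial_le_four_pow (n i : ℕ) (hi : i < n) :
    n.factorial ≤ 4 ^ n * (i.factorial * (n - 1 - i).factorial) := by
  obtain ⟨m, rfl⟩ : ∃ m, n = m + 1 := ⟨n - 1, by omega⟩
  rw [Nat.add_sub_cancel, Nat.factorial_succ,
    ← Nat.choose_mul_factorial_mul_factorial (Nat.lt_succ_iff.1 hi), mul_assoc, ← mul_assoc]
  refine Nat.mul_le_mul_right _ ?_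
  calc (m + 1) * m.choose i ≤ 2 ^ (m + 1) * 2 ^ m :=
        Nat.mul_le_mul Nat.lt_two_pow_self.le (Nat.choose_le_two_pow m i)
    _ ≤ 2 ^ (m + 1) * 2 ^ (m + 1) := Nat.mul_le_mul_left _ (Nat.pow_le_pow_right two_pos m.le_succ)
    _ = 4 ^ (m + 1) := by norm_num [← mul_pow]

theorem weight_mul_weight_le (s : ℝ≥0) {r : ℝ} (hr : 0 < r) (n i : ℕ) (hi : i < n) :
    weight s r i * weight s r (n - 1 - i) ≤
      r⁻¹ * ((r * (4 : ℝ) ^ (s : ℝ)) ^ n / (n.factorial : ℝ) ^ (s : ℝ)) := by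
  have h : (n.factorial : ℝ) ^ (s : ℝ) ≤
      ((4 : ℝ) ^ (s : ℝ)) ^ n * ((i.factorial : ℝ) * ((n - 1 - i).factorial : ℝ)) ^ (s : ℝ) := by
    rw [← Real.rpow_natCast, ← Real.rpow_mul (by norm_num), mul_comm (s : ℝ),
      Real.rpow_mul (by norm_num), Real.rpow_natCast, ← Real.mul_rpow (by positivity)
      (by positivity)]
    exact Real.rpow_le_rpow (by positivity) (by exact_mod_cast factorial_le_four_pow n i hi) s.2
  have hp : r ^ i * r ^ (n - 1 - i) = r⁻¹ * r ^ n := by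
    rw [← pow_add, eq_inv_mul_iff_mul_eq₀ hr.ne', ← pow_succ']
    congr 1
    omega
  unfold weight
  rw [div_mul_div_comm, hp, ← Real.mul_rpow (by positivity) (by positivity), mul_div_assoc, mul_pow,
    mul_div_assoc]
  refine mul_le_mul_of_nonneg_left ?_ (by positivity)
  rw [div_eq_mul_inv]
  refine mul_le_mul_of_nonneg_left ?_ (by positivity)
  rw [inv_le_iff_one_le_mul₀ (by positivity), div_mul_eq_mul_div, one_le_div (by positivity)]
  exact h

theorem isWeightedPowerAlgebra_powerAlgebra (s : ℝ≥0) :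
    IsWeightedPowerAlgebra (toPowerAlgebra s) (PowerAlgebra.coeff s)
      (fun r : {r : ℝ // 0 < r} => weight s r) (PowerAlgebra.seminorm s) where
  withSeminorms := ⟨rfl⟩
  nonneg r n := weight_nonneg s r.2 n
  pos n := ⟨⟨1, one_pos⟩, by unfold weight; positivity⟩
  hasSum r a := (a.2 r r.2).hasSum
  injective a b h := Subtype.ext (PowerSeries.ext fun n => congrFun h n)
  exists_of_summable a ha := ⟨⟨PowerSeries.mk a, fun r hr => by
    simpa using ha ⟨r, hr⟩⟩, funext fun n => PowerSeries.coeff_mk n a⟩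
  coeff_map q n := Polynomial.coeff_coe q n
  coeff_mul a b n := by
    simp only [PowerAlgebra.coeff_apply, map_mul]
    exact PowerSeries.coeff_mul _ _ _
  directed r r' := ⟨⟨max r r', lt_max_of_lt_left r.2⟩, weight_mono s r.2 (le_max_left _ _),
    weight_mono s r'.2 (le_max_right _ _)⟩
  weight_add_le r m n := TopHomology.weight_add_le s r.2 m n
  sum_weight_le r := by
    have hr := r.2
    -- The factor `4 ^ s` comes from the factorial estimate; the factor `2` absorbs the number `n ≤
    -- 2 ^ n` of summands.
    refine ⟨(r : ℝ)⁻¹, ⟨2 * (r * (4 : ℝ) ^ (s : ℝ)), by positivity⟩, by positivity, fun n => ?_⟩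
    refine (Finset.sum_le_card_nsmul _ _ _ fun i hi =>
      weight_mul_weight_le s hr n i (Finset.mem_range.1 hi)).trans ?_
    rw [Finset.card_range, nsmul_eq_mul]
    have h2 : (n : ℝ) ≤ 2 ^ n := by exact_mod_cast Nat.lt_two_pow_self.le
    refine (mul_le_mul_of_nonneg_right h2 (by positivity)).trans_eq ?_
    unfold weight
    rw [mul_pow 2]
    ring

end FiniteOrder

/-! ### The algebra of formal power series: indicator weights. -/

section InfiniteOrder

/-- The seminorm `∑ |aₙ|`, `n ≤ N`, on formal power series. -/
def powerSeriesSeminorm : SeminormFamily ℂ (PowerSeries ℂ) ℕ := fun N =>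
  Seminorm.of (fun a => ∑ n ∈ Finset.range (N + 1), ‖PowerSeries.coeff n a‖)
    (fun a b => by
      rw [← Finset.sum_add_distrib]
      exact Finset.sum_le_sum fun n _ => by rw [map_add]; exact norm_add_le _ _)
    (fun c a => by
      rw [Finset.mul_sum]
      exact Finset.sum_congr rfl fun n _ => by rw [map_smul, norm_smul])

theorem powerSeriesSeminorm_apply (N : ℕ) (a : PowerSeries ℂ) :
    powerSeriesSeminorm N a = ∑ n ∈ Finset.range (N + 1), ‖PowerSeries.coeff n a‖ := rfl

/-- Each seminorm is a finite sum of coefficient norms, and conversely dominates the coefficients it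
contains. -/
theorem withSeminorms_powerSeries : WithSeminorms powerSeriesSeminorm := by
  refine powerSeriesSeminorm.withSeminorms_iff_nhds_eq_iInf.2 (le_antisymm ?_ ?_)
  · refine le_iInf fun N => tendsto_iff_comap.1 ?_
    have hc : Continuous (powerSeriesSeminorm N) :=
      continuous_finsetSum (Finset.range (N + 1)) fun n _ =>
        (PowerSeries.WithPiTopology.continuous_coeff ℂ n).norm
    have := hc.tendsto 0
    rwa [map_zero] at this
  · refine (PowerSeries.WithPiTopology.tendsto_iff_coeff_tendsto ℂ id _ 0).2 fun d => ?_
    rw [map_zero]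
    have h : Tendsto (powerSeriesSeminorm d) (⨅ N, comap (powerSeriesSeminorm N) (𝓝 0)) (𝓝 0) :=
      tendsto_comap.mono_left (iInf_le _ d)
    refine squeeze_zero_norm (fun a => ?_) h
    exact Finset.single_le_sum (f := fun n => ‖PowerSeries.coeff n a‖)
      (fun n _ => norm_nonneg _) (Finset.self_mem_range_succ d)

theorem isWeightedPowerAlgebra_powerSeries :
    IsWeightedPowerAlgebra toPowerSeries (LinearMap.pi fun n => PowerSeries.coeff n)
      (fun N n => if n ≤ N then (1 : ℝ) else 0) powerSeriesSeminorm where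
  withSeminorms := withSeminorms_powerSeries
  nonneg N n := by split_ifs <;> simp
  pos n := ⟨n, by simp⟩
  hasSum N a := by
    have h : ∀ n, ‖PowerSeries.coeff n a‖ * (if n ≤ N then (1 : ℝ) else 0) =
        if n ∈ Finset.range (N + 1) then ‖PowerSeries.coeff n a‖ else 0 := fun n => by
      simp
    rw [powerSeriesSeminorm_apply]
    change HasSum (fun n => ‖PowerSeries.coeff n a‖ * (if n ≤ N then (1 : ℝ) else 0)) _
    simp only [h]
    have := hasSum_sum_of_ne_finset_zero (L := SummationFilter.unconditional ℕ)
      (s := Finset.range (N + 1))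
      (f := fun n => if n ∈ Finset.range (N + 1) then ‖PowerSeries.coeff n a‖ else 0)
      fun n hn => if_neg hn
    rwa [Finset.sum_congr rfl fun n hn => if_pos hn] at this
  injective a b h := PowerSeries.ext fun n => congrFun h n
  exists_of_summable a _ := ⟨PowerSeries.mk a, funext fun n => PowerSeries.coeff_mk n a⟩
  coeff_map q n := Polynomial.coeff_coe q n
  coeff_mul a b n := PowerSeries.coeff_mul n a b
  directed k l := ⟨max k l, fun n => by split_ifs <;> grind, fun n => by split_ifs <;> grind⟩
  weight_add_le N m n := by
    split_ifs <;> first | omega | norm_num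
  sum_weight_le N := by
    -- If `n > 2 * N + 1`, then `i + (n - 1 - i) > 2 * N`, so one index exceeds `N` and every term
    -- vanishes. Otherwise there are at most `2 * N + 1` terms, each at most `1`.
    refine ⟨2 * N + 1, 2 * N + 1, by positivity, fun n => ?_⟩
    split_ifs with hn
    · have h : ∀ i ∈ Finset.range n, (if i ≤ N then (1 : ℝ) else 0) *
          (if n - 1 - i ≤ N then (1 : ℝ) else 0) ≤ 1 := fun i _ => by
        split_ifs <;> norm_num
      refine (Finset.sum_le_card_nsmul _ _ _ h).trans ?_
      rw [Finset.card_range, nsmul_eq_mul, mul_one, mul_one]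
      exact_mod_cast hn
    · rw [mul_zero]
      refine (Finset.sum_eq_zero fun i hi => ?_).le
      have hi := Finset.mem_range.1 hi
      split_ifs <;> first | omega | norm_num

end InfiniteOrder

end TopHomology

end

theorem mainTheorem7 :
    (∀ s : ℝ≥0, TopHomology.IsHomologicalEpi (TopHomology.toPowerAlgebra s)) ∧
      TopHomology.IsHomologicalEpi TopHomology.toPowerSeries :=
  ⟨fun s => (TopHomology.isWeightedPowerAlgebra_powerAlgebra s).isHomologicalEpi,
    TopHomology.isWeightedPowerAlgebra_powerSeries.isHomologicalEpi⟩
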